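/- Let $N_1,\dots,N_L\ge 1$, $N=\sum_l N_l$, and let sensor $(k,l)$, $1\le k\le N_l$, $1\le l\le L$, observe $X^{k,l}_t$, $t\ge 1$; all observations are independent, with law $f_l$ for $t\le\nu$ and law $g_l$ for $t>\nu$. Write $P_\nu,E_\nu$ for the resulting probability and expectation ($\nu=\infty$: no change). Assume that $f_l$ and $g_l$ are mutually absolutely continuous, let $\mathcal I_l=D(g_l\|f_l)$ be the Kullback--Leibler divergence, and assume $0<\mathcal I_1\le\dots\le\mathcal I_{L-1}<\mathcal I_L<\infty$. Let $Z^{k,l}_t=\log\frac{dg_l}{df_l}(X^{k,l}_t)$ and assume $\sigma_l^2=E_0[(Z^{k,l}_t-\mathcal I_l)^2]<\infty$. Let $W^{k,l}_0=0$, $W^{k,l}_t=\max\{0,W^{k,l}_{t-1}\}+Z^{k,l}_t$ be the local CUSUM statistics. For $\mathbf h=(\mathcal I_1h,\dots,\mathcal I_Lh)$ and $1\le M\le N$ consider the $M$-th alarm rule and the $M$ voting rule $$\rho^{(M)}(\mathbf h)=\inf\{t:|\{(k,l):\max_{s\le t}W^{k,l}_s>\mathcal I_lh\}|\ge M\},\qquad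 \rho_M(\mathbf h)=\inf\{t:|\{(k,l):W^{k,l}_t>\mathcal I_lh\}|\ge M\}.$$ Let $\lambda(m)$ be the $l$ with $\sum_{j<l}N_j<m\le\sum_{j\le l}N_j$, and let $\xi_M$ be the mean of the $M$-th order statistic ($M$-th smallest value) of independent Gaussians $G_{k,l}\sim N(0,\sigma_l^2/\mathcal I_l^2)$, $1\le k\le N_l$, $1\le l\le L$. The second-order expansions at false alarm level $\gamma$ are $$A_M(\gamma)=\frac{\log\gamma}{\mathcal I_{\lambda(M)}}+\xi_M\sqrt{\frac{\log\gamma}{\mathcal I_{\lambda(M)}}},\qquad B_M(\gamma)=\frac{\log\gamma}{\sum_{m=1}^M\mathcal I_{\lambda(m)}}+\xi_M\sqrt{\frac{\log\gamma}{\sum_{m=1}^M\mathcal I_{\lambda(m)}}}$$ for $E_0[\rho^{(M)}]$ and (as an upper bound) for $E_0[\rho_M]$, respectively. Then, for all sufficiently large $\gamma$, the best choices among $1\le M\le N$ are $M=M^*:=N-N_L+1$ for the $M$-th alarm rule and $M=N$ for the $M$ voting rule, in each of the following senses: (1) $M^*$ is the unique minimizer of $M\mapsto A_M(\gamma)$,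 and $N$ is the unique minimizer of $M\mapsto B_M(\gamma)$; (2) if $M\ne M^*$ and thresholds $h,h'$ satisfy $E_\infty[\rho^{(M^*)}(\mathbf h)]=\gamma=E_\infty[\rho^{(M)}(\mathbf h')]$, where $\mathbf h=(\mathcal I_lh)_l$ and $\mathbf h'=(\mathcal I_lh')_l$, then $E_0[\rho^{(M^*)}(\mathbf h)]<E_0[\rho^{(M)}(\mathbf h')]$; likewise for $\rho_N$ against $\rho_M$ with $M\ne N$; (3) $\inf_h\{E_0[\rho^{(M)}(\mathbf h)]:E_\infty[\rho^{(M)}(\mathbf h)]>\gamma\}$ is strictly smaller for $M=M^*$ than for any other $M$, and $\inf_h\{E_0[\rho_M(\mathbf h)]:E_\infty[\rho_M(\mathbf h)]>\gamma\}$ is strictly smaller for $M=N$ than for any other $M$. -/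

import Mathlib

open MeasureTheory ProbabilityTheory Filter
open scoped ENNReal

noncomputable section

namespace HetQCD

/-- The sensors: there are `K + 1` types, labelled by `Fin (K + 1)`, and `n l` sensors of type `l`.
The type of a sensor `s` is `s.1`. -/
abbrev Sensor {K : ℕ} (n : Fin (K + 1) → ℕ) : Type := Σ l : Fin (K + 1), Fin (n l)

/-- All observations: `x (t, s)` is the observation of sensor `s` at time `t` (times `t ≥ 1` are
used). -/
abbrev Obs (𝓧 : Type*) {K : ℕ} (n : Fin (K + 1) → ℕ) : Type _ := ℕ × Sensor n → 𝓧

section Model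

variable {𝓧 : Type*} [MeasurableSpace 𝓧] {K : ℕ}

/-- The law `P_ν` of the observations when the change happens at time `ν` (`ν = ⊤`: no change):
all observations are independent, those of type `l` have law `f l` up to time `ν` and `g l`
afterwards. -/
def law (n : Fin (K + 1) → ℕ) (f g : Fin (K + 1) → Measure 𝓧) (ν : ℕ∞) : Measure (Obs 𝓧 n) :=
  Measure.infinitePi fun p : ℕ × Sensor n => if (p.1 : ℕ∞) ≤ ν then f p.2.1 else g p.2.1

/-- The Kullback-Leibler divergence `I_l = D(g_l ‖ f_l)`, as a real number. -/
def kld (f g : Fin (K + 1) → Measure 𝓧) (l : Fin (K + 1)) : ℝ :=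
  (InformationTheory.klDiv (g l) (f l)).toReal

/-- The variance `σ_l²` of the log-likelihood ratio under the post-change law. -/
def llrVar (f g : Fin (K + 1) → Measure 𝓧) (l : Fin (K + 1)) : ℝ :=
  ∫ x, (llr (g l) (f l) x - kld f g l) ^ 2 ∂(g l)

variable (n : Fin (K + 1) → ℕ) (f g : Fin (K + 1) → Measure 𝓧)

/-- The local CUSUM statistic `W_t` of sensor `s`. -/
def cusum (s : Sensor n) (x : Obs 𝓧 n) : ℕ → ℝ
  | 0 => 0
  | t + 1 => max 0 (cusum s x t) + llr (g s.1) (f s.1) (x (t + 1, s))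

/-- The anonymous `M`-th alarm rule with thresholds `h_l = thr l`: the first time at which at least
`M` sensors have exceeded their threshold at least once. -/
def alarmRule (M : ℕ) (thr : Fin (K + 1) → ℝ) (x : Obs 𝓧 n) : ℝ≥0∞ :=
  ⨅ (t : ℕ) (_ : M ≤ {s : Sensor n | ∃ r ≤ t, thr s.1 < cusum n f g s x r}.ncard), (t : ℝ≥0∞)

/-- The anonymous `M` voting rule with thresholds `h_l = thr l`: the first time at which at least
`M` sensors exceed their threshold simultaneously. -/
def votingRule (M : ℕ) (thr : Fin (K + 1) → ℝ) (x : Obs 𝓧 n) : ℝ≥0∞ :=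
  ⨅ (t : ℕ) (_ : M ≤ {s : Sensor n | thr s.1 < cusum n f g s x t}.ncard), (t : ℝ≥0∞)

/-- The threshold vector `(I_1 h, …, I_L h)`. -/
def thresholds (h : ℝ) (l : Fin (K + 1)) : ℝ := kld f g l * h

/-- Average run length to false alarm `E_∞[ρ]`. -/
def arl (ρ : Obs 𝓧 n → ℝ≥0∞) : ℝ≥0∞ := ∫⁻ x, ρ x ∂(law n f g ⊤)

/-- Expected detection delay `E_0[ρ]`. -/
def delay (ρ : Obs 𝓧 n → ℝ≥0∞) : ℝ≥0∞ := ∫⁻ x, ρ x ∂(law n f g 0)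

/-- The smallest expected detection delay within a family of rules indexed by `h`, subject to an
average run length to false alarm larger than `γ`. -/
def minDelay (ρ : ℝ → Obs 𝓧 n → ℝ≥0∞) (γ : ℝ) : ℝ≥0∞ :=
  ⨅ (h : ℝ) (_ : ENNReal.ofReal γ < arl n f g (ρ h)), delay n f g (ρ h)

/-- The `M`-th alarm rule with thresholds `I_l h`. -/
def alarm (M : ℕ) (h : ℝ) : Obs 𝓧 n → ℝ≥0∞ := alarmRule n f g M (thresholds f g h)

/-- The `M` voting rule with thresholds `I_l h`. -/
def voting (M : ℕ) (h : ℝ) : Obs 𝓧 n → ℝ≥0∞ := votingRule n f g M (thresholds f g h)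

/-- `typeOf n m` is the type `l` with `∑_{j < l} n j < m ≤ ∑_{j ≤ l} n j`, for `1 ≤ m ≤ ∑ l, n l`
(it is the least `l` with `m ≤ ∑_{j ≤ l} n j`). -/
def typeOf (m : ℕ) : Fin (K + 1) :=
  (Finset.univ.filter fun l : Fin (K + 1) => m ≤ ∑ j ∈ Finset.Iic l, n j).inf id

/-- The `M`-th order statistic (the `M`-th smallest entry) of a finite family of reals. -/
def orderStat {ι : Type*} (M : ℕ) (y : ι → ℝ) : ℝ := sInf {a : ℝ | M ≤ {i | y i ≤ a}.ncard}

/-- `ξ_M`: the expected `M`-th order statistic of independent Gaussian random variables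
`G_s ∼ N(0, σ_l² / I_l²)`, one for each sensor `s` (of type `l`). -/
def xi (M : ℕ) : ℝ :=
  ∫ y, orderStat M y ∂(Measure.pi fun s : Sensor n =>
    gaussianReal 0 (llrVar f g s.1 / kld f g s.1 ^ 2).toNNReal)

/-- `a + ξ_M √a`, the second-order approximation of the delay with first-order term `a`. -/
def expansion (M : ℕ) (a : ℝ) : ℝ := a + xi n f g M * √a

/-- Second-order expansion of the delay of the `M`-th alarm rule at false alarm level `γ`. -/
def alarmExpansion (M : ℕ) (γ : ℝ) : ℝ :=
  expansion n f g M (Real.log γ / kld f g (typeOf n M))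

/-- Second-order expansion (upper bound) of the delay of the `M` voting rule at false alarm
level `γ`. -/
def votingExpansion (M : ℕ) (γ : ℝ) : ℝ :=
  expansion n f g M (Real.log γ / ∑ m ∈ Finset.Icc 1 M, kld f g (typeOf n m))

end Model

end HetQCD

end

/-! Every comparison goes through one sandwich, `EventuallyBetter`: for large `γ` there are a
threshold `h` at which the claimed optimum has average run length above `γ` and a threshold `h'` at
which the competitor has average run length below `γ`, with the first delay smaller than the second.
Both quantities increase with the threshold, so this gives the comparison at average run length
exactly `γ` as well as the comparison of constrained infima (`EventuallyBetter.delay_lt`). Exact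
asymptotics of the optimal delays are never needed.

After the change, sensor `s` drifts upwards at rate `I s` towards `I s * h`, so every rule has delay
`h (1 + o(1))`. Before the change, a rule that needs the sensors of a set `A` simultaneously has
average run length `exp (h ∑ I s)` up to `exp (o(h))`, the sum being over `A`; for alarms that need
not be simultaneous, the largest `I s` in `A` replaces the sum. Upper bounds come from independent
block trials (`setLIntegral_le_of_trials`), with success probability estimated by change of measure
and the central limit theorem (`eventually_exp_le_sumLaw`). Lower bounds come from the tail `exp
(-c)` of the CUSUM statistic and a union bound over time (`lintegral_firstTime_ge`).

Voting with all sensors has a strictly larger exponent than voting with fewer. Any `Ma` sensors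
include one of the last type, whereas fewer alarms can come from the other types alone, again with a
strictly smaller exponent. `eventually_exists_thresholds_of_lt` settles these cases at first order.

For more than `Ma` alarms the exponents agree and the decision is of order `√h`. The additional
alarms cost a delay of at least `c √h` at the same `h` (`exists_eventually_delay_gap`), while their
run length gains at most `exp (δ √h)` for every `δ > 0`. Since the delay is Lipschitz in `h` up to
an additive constant (`exists_delay_alarmTime_le_add`), lowering the competitor's threshold by a
small multiple of `√h` removes its gain in run length but not its loss in delay
(`eventually_exists_thresholds_of_gap`).

The expansions are compared by their leading terms and, when these coincide, by strict monotonicity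
of expected Gaussian order statistics (`xi_lt`). -/

namespace HetQCD

/-! ### Paths: block sums, CUSUM statistics, first times -/

/-- The sum `ζ (t₀ + 1) + ⋯ + ζ (t₀ + T)`. -/
noncomputable def blockSum (ζ : ℕ → ℝ) (t₀ T : ℕ) : ℝ := ∑ i ∈ Finset.range T, ζ (t₀ + i + 1)

/-- The CUSUM statistic of the increments `ζ 1, ζ 2, …`. -/
noncomputable def pathCusum (ζ : ℕ → ℝ) : ℕ → ℝ
  | 0 => 0
  | t + 1 => max 0 (pathCusum ζ t) + ζ (t + 1)

lemma blockSum_succ (ζ : ℕ → ℝ) (t₀ T : ℕ) :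
    blockSum ζ t₀ (T + 1) = blockSum ζ t₀ T + ζ (t₀ + T + 1) :=
  Finset.sum_range_succ _ _

/-- The maximum with zero can only help, so the CUSUM statistic dominates a sum started at any time.
This makes disjoint blocks into independent trials. -/
lemma blockSum_le_pathCusum (ζ : ℕ → ℝ) (t₀ : ℕ) {T : ℕ} (hT : 0 < T) :
    blockSum ζ t₀ T ≤ pathCusum ζ (t₀ + T) := by
  induction T, hT using Nat.le_induction with
  | base =>
    simp only [blockSum, pathCusum, Finset.range_one, Finset.sum_singleton, add_zero]
    linarith [le_max_left 0 (pathCusum ζ t₀)]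
  | succ T _ ih =>
    rw [blockSum_succ, ← add_assoc, pathCusum]
    linarith [le_max_right 0 (pathCusum ζ (t₀ + T))]

/-- The CUSUM statistic is the partial sum minus an earlier minimum of the partial sums. With
nonnegative drift that minimum is at least `-c`, and the partial sum is at most its drift plus `c`.
-/
lemma pathCusum_le_of_blockSum_bound {ζ : ℕ → ℝ} {I c : ℝ} {t : ℕ} (hI : 0 ≤ I)
    (hc : ∀ i ≤ t, |blockSum ζ 0 i - I * i| ≤ c) {r : ℕ} (hr : r ≤ t) :
    pathCusum ζ r ≤ I * t + 2 * c := by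
  have key : ∀ i ≤ t, max 0 (pathCusum ζ i) ≤ blockSum ζ 0 i + c := by
    intro i
    induction i with
    | zero =>
      intro _
      have := hc 0 (Nat.zero_le _)
      simp only [blockSum, Finset.range_zero, Finset.sum_empty, Nat.cast_zero, mul_zero,
        sub_zero, abs_zero] at this
      simp [pathCusum, blockSum, this]
    | succ i ih =>
      intro hi
      have h1 := ih (by omega)
      have h2 := neg_le_of_abs_le (hc (i + 1) hi)
      have h3 : 0 ≤ I * ((i + 1 : ℕ) : ℝ) := by positivity
      refine max_le (by linarith) ?_
      rw [pathCusum, blockSum_succ, zero_add]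
      linarith
  have h1 := le_of_max_le_right (key r hr)
  have h2 := le_of_abs_le (hc r hr)
  have h3 : I * (r : ℝ) ≤ I * t := by gcongr
  linarith

/-- The first time at which `p` holds. -/
noncomputable def firstTime (p : ℕ → Prop) : ℝ≥0∞ := ⨅ (t : ℕ) (_ : p t), (t : ℝ≥0∞)

lemma firstTime_le {p : ℕ → Prop} {t : ℕ} (h : p t) : firstTime p ≤ t := iInf₂_le t h

lemma le_firstTime {p : ℕ → Prop} {a : ℝ≥0∞} (h : ∀ t, p t → a ≤ t) : a ≤ firstTime p :=
  le_iInf₂ h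

lemma firstTime_anti {p q : ℕ → Prop} (h : ∀ t, p t → q t) : firstTime q ≤ firstTime p :=
  le_firstTime fun _ ht => firstTime_le (h _ ht)

lemma measurable_firstTime {Ω : Type*} [MeasurableSpace Ω] {p : Ω → ℕ → Prop}
    (hp : ∀ t, MeasurableSet {ω | p ω t}) : Measurable fun ω => firstTime (p ω) := by
  classical
  refine Measurable.iInf fun t => ?_
  have : (fun ω => ⨅ (_ : p ω t), (t : ℝ≥0∞)) = fun ω => if p ω t then (t : ℝ≥0∞) else ⊤ := by
    ext ω
    by_cases h : p ω t <;> simp [h]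
  rw [this]
  exact Measurable.ite (hp t) measurable_const measurable_const

lemma le_ncard_iff {S : Type*} [Fintype S] {M : ℕ} {q : S → Prop} :
    M ≤ {s | q s}.ncard ↔ ∃ A : Finset S, A.card = M ∧ ∀ s ∈ A, q s := by
  classical
  constructor
  · intro h
    rw [Set.ncard_eq_toFinset_card' {s | q s}] at h
    obtain ⟨A, hA, hc⟩ := Finset.exists_subset_card_eq h
    exact ⟨A, hc, fun s hs => by simpa using hA hs⟩
  · rintro ⟨A, rfl, hA⟩
    rw [← Set.ncard_coe_finset A]
    exact Set.ncard_le_ncard hA (Set.toFinite _)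

lemma measurableSet_le_ncard {Ω S : Type*} [MeasurableSpace Ω] [Fintype S] {M : ℕ}
    {q : Ω → S → Prop} (hq : ∀ s, MeasurableSet {ω | q ω s}) :
    MeasurableSet {ω | M ≤ {s | q ω s}.ncard} := by
  simp_rw [le_ncard_iff]
  have : {ω | ∃ A : Finset S, A.card = M ∧ ∀ s ∈ A, q ω s} =
      ⋃ (A : Finset S) (_ : A.card = M), ⋂ s ∈ A, {ω | q ω s} := by
    ext ω; simp
  rw [this]
  exact MeasurableSet.iUnion fun A => MeasurableSet.iUnion fun _ =>
    Finset.measurableSet_biInter A fun s _ => hq s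

/-! ### Independent samples -/

/-- The law of the sum of `T` independent random variables with law `μ`. -/
noncomputable def sumLaw (μ : Measure ℝ) : ℕ → Measure ℝ
  | 0 => Measure.dirac 0
  | T + 1 => (sumLaw μ T).conv μ

instance {μ : Measure ℝ} [IsProbabilityMeasure μ] (T : ℕ) : IsProbabilityMeasure (sumLaw μ T) := by
  induction T with
  | zero => exact Measure.dirac.isProbabilityMeasure
  | succ T ih => rw [sumLaw]; infer_instance

/-- Exponential tilting is multiplicative: the exponential turns the sum of log-likelihood ratios
into the product of the likelihood ratios. -/
lemma lintegral_sumLaw_of_tilt {F G : Measure ℝ} [IsProbabilityMeasure F] [IsProbabilityMeasure G]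
    (hFG : ∀ φ : ℝ → ℝ≥0∞, Measurable φ →
      ∫⁻ x, φ x ∂G = ∫⁻ x, φ x * ENNReal.ofReal (Real.exp x) ∂F) (T : ℕ) :
    ∀ φ : ℝ → ℝ≥0∞, Measurable φ →
      ∫⁻ x, φ x ∂(sumLaw G T) = ∫⁻ x, φ x * ENNReal.ofReal (Real.exp x) ∂(sumLaw F T) := by
  induction T with
  | zero => intro φ hφ; simp [sumLaw]
  | succ T ih =>
    intro φ hφ
    have hm : Measurable fun x => φ x * ENNReal.ofReal (Real.exp x) := by fun_prop
    rw [sumLaw, sumLaw, Measure.lintegral_conv hφ, Measure.lintegral_conv hm, ih]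
    · refine lintegral_congr fun x => ?_
      rw [hFG _ (by fun_prop), ← lintegral_mul_const _ (by fun_prop)]
      refine lintegral_congr fun y => ?_
      rw [Real.exp_add, ENNReal.ofReal_mul (Real.exp_pos _).le]
      ring
    · exact Measurable.lintegral_prod_right' (f := fun p : ℝ × ℝ => φ (p.1 + p.2)) (by fun_prop)

/-- On the interval the density of the tilted law is at most `exp c`. The upper endpoint is
therefore the price of the change of measure, and the interval should be short. -/
lemma sumLaw_Ioi_ge_of_tilt {F G : Measure ℝ} [IsProbabilityMeasure F] [IsProbabilityMeasure G]
    (hFG : ∀ φ : ℝ → ℝ≥0∞, Measurable φ →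
      ∫⁻ x, φ x ∂G = ∫⁻ x, φ x * ENNReal.ofReal (Real.exp x) ∂F) (T : ℕ) (b c : ℝ) :
    ENNReal.ofReal (Real.exp (-c)) * sumLaw G T (Set.Ioo b c) ≤ sumLaw F T (Set.Ioi b) := by
  have h : sumLaw G T (Set.Ioo b c) ≤
      ENNReal.ofReal (Real.exp c) * sumLaw F T (Set.Ioi b) := by
    rw [← lintegral_indicator_one measurableSet_Ioo, lintegral_sumLaw_of_tilt hFG T _
      (measurable_one.indicator measurableSet_Ioo), ← lintegral_indicator_one measurableSet_Ioi,
      ← lintegral_const_mul _ (measurable_one.indicator measurableSet_Ioi)]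
    refine lintegral_mono fun x => ?_
    by_cases hx : x ∈ Set.Ioo b c
    · have : x ∈ Set.Ioi b := hx.1
      simp only [Set.indicator_of_mem hx, Set.indicator_of_mem this, Pi.one_apply, one_mul,
        mul_one]
      exact ENNReal.ofReal_le_ofReal (Real.exp_le_exp.2 hx.2.le)
    · simp [hx]
  calc _ ≤ ENNReal.ofReal (Real.exp (-c)) *
        (ENNReal.ofReal (Real.exp c) * sumLaw F T (Set.Ioi b)) := by gcongr
    _ = _ := by
      rw [← mul_assoc, ← ENNReal.ofReal_mul (Real.exp_pos _).le, ← Real.exp_add]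
      simp

variable {Ω S : Type*} {mΩ : MeasurableSpace Ω} {P : Measure Ω}

/-- The random variables `Z (t, s)` are independent and, for `t ≥ 1`, have law `μ s`. -/
structure IsSample (Z : ℕ × S → Ω → ℝ) (μ : S → Measure ℝ) (P : Measure Ω) : Prop where
  measurable : ∀ p, Measurable (Z p)
  iIndepFun : iIndepFun Z P
  map_eq : ∀ t s, P.map (Z (t + 1, s)) = μ s

/-- The σ-algebra generated by the random variables `Z p`, `p ∈ J`. -/
def sig {ι : Type*} (Z : ι → Ω → ℝ) (J : Set ι) : MeasurableSpace Ω :=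
  ⨆ p ∈ J, (borel ℝ).comap (Z p)

/-- The CUSUM statistic of sensor `s`. -/
noncomputable def sensorCusum (Z : ℕ × S → Ω → ℝ) (s : S) (t : ℕ) (ω : Ω) : ℝ :=
  pathCusum (fun t => Z (t, s) ω) t

/-- The sum of the increments of sensor `s` at times `t₀ + 1, …, t₀ + T`. -/
noncomputable def sensorSum (Z : ℕ × S → Ω → ℝ) (s : S) (t₀ T : ℕ) (ω : Ω) : ℝ :=
  blockSum (fun t => Z (t, s) ω) t₀ T

variable {Z : ℕ × S → Ω → ℝ} {μ : S → Measure ℝ}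

lemma measurableSet_sig_mono {ι : Type*} {Z : ι → Ω → ℝ} {J J' : Set ι}
    (h : ∀ p ∈ J, p ∈ J') {E : Set Ω} (hE : MeasurableSet[sig Z J] E) :
    MeasurableSet[sig Z J'] E :=
  (biSup_mono h : sig Z J ≤ sig Z J') E hE

lemma measurable_sig {ι : Type*} {Z : ι → Ω → ℝ} {J : Set ι} {p : ι} (hp : p ∈ J) :
    Measurable[sig Z J] (Z p) := by
  have h : (borel ℝ).comap (Z p) ≤ sig Z J :=
    le_biSup (fun p => (borel ℝ).comap (Z p)) hp
  rw [← BorelSpace.measurable_eq] at h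
  exact Measurable.of_comap_le h

lemma measurable_sensorSum_sig {J : Set (ℕ × S)} {s : S} {t₀ T : ℕ}
    (hJ : ∀ t, t₀ < t → t ≤ t₀ + T → (t, s) ∈ J) : Measurable[sig Z J] (sensorSum Z s t₀ T) := by
  unfold sensorSum blockSum
  refine Finset.measurable_fun_sum _ fun i hi => ?_
  have := Finset.mem_range.1 hi
  exact measurable_sig (hJ _ (by omega) (by omega))

lemma measurable_sensorCusum_sig {J : Set (ℕ × S)} {s : S} {t : ℕ}
    (hJ : ∀ r, 0 < r → r ≤ t → (r, s) ∈ J) : Measurable[sig Z J] (sensorCusum Z s t) := by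
  induction t with
  | zero => exact measurable_const
  | succ t ih =>
    have h1 := ih fun r h h' => hJ r h (by omega)
    have h2 : Measurable[sig Z J] (Z (t + 1, s)) := measurable_sig (hJ _ (by omega) le_rfl)
    exact (measurable_const.max h1).add h2

namespace IsSample

variable (hZ : IsSample Z μ P)
include hZ

lemma sig_le (J : Set (ℕ × S)) : sig Z J ≤ mΩ := by
  refine iSup₂_le fun p _ => ?_
  rw [← BorelSpace.measurable_eq (α := ℝ)]
  exact (hZ.measurable p).comap_le

lemma indep_sig {J J' : Set (ℕ × S)} (h : Disjoint J J') : Indep (sig Z J) (sig Z J') P := by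
  have h1 := hZ.iIndepFun
  rw [iIndepFun_iff_iIndep] at h1
  have h2 := indep_iSup_of_disjoint (fun p => (hZ.measurable p).comap_le) h1 h
  rwa [BorelSpace.measurable_eq (α := ℝ)] at h2

lemma measure_inter {J J' : Set (ℕ × S)} (h : Disjoint J J') {A B : Set Ω}
    (hA : MeasurableSet[sig Z J] A) (hB : MeasurableSet[sig Z J'] B) :
    P (A ∩ B) = P A * P B :=
  (Indep_iff _ _ P).1 (hZ.indep_sig h) A B hA hB

lemma indepFun {J J' : Set (ℕ × S)} (h : Disjoint J J') {X Y : Ω → ℝ}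
    (hX : Measurable[sig Z J] X) (hY : Measurable[sig Z J'] Y) : IndepFun X Y P := by
  rw [IndepFun_iff_Indep]
  exact indep_of_indep_of_le_left (indep_of_indep_of_le_right (hZ.indep_sig h) hY.comap_le)
    hX.comap_le

lemma measurable_sensorSum (s : S) (t₀ T : ℕ) : Measurable (sensorSum Z s t₀ T) :=
  (measurable_sensorSum_sig (J := Set.univ) fun _ _ _ => trivial).mono (hZ.sig_le _) le_rfl

lemma measurable_sensorCusum (s : S) (t : ℕ) : Measurable (sensorCusum Z s t) :=
  (measurable_sensorCusum_sig (J := Set.univ) fun _ _ _ => trivial).mono (hZ.sig_le _) le_rfl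

lemma map_sensorSum [IsProbabilityMeasure P] (s : S) (t₀ T : ℕ) :
    P.map (sensorSum Z s t₀ T) = sumLaw (μ s) T := by
  induction T with
  | zero =>
    have : sensorSum Z s t₀ 0 = fun _ => 0 := by ext; simp [sensorSum, blockSum]
    rw [this, Measure.map_const, sumLaw, measure_univ, one_smul]
  | succ T ih =>
    have h1 : sensorSum Z s t₀ (T + 1) = sensorSum Z s t₀ T + Z (t₀ + T + 1, s) := by
      ext ω; exact blockSum_succ _ _ _
    have h2 : IndepFun (sensorSum Z s t₀ T) (Z (t₀ + T + 1, s)) P := by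
      refine hZ.indepFun (J := {p | p.1 ≤ t₀ + T}) (J' := {p | t₀ + T < p.1}) ?_
        (measurable_sensorSum_sig fun t _ h => h) (measurable_sig (Nat.lt_succ_self (t₀ + T)))
      exact Set.disjoint_left.2 fun p (h : p.1 ≤ t₀ + T) (h' : t₀ + T < p.1) => by omega
    rw [h1, h2.map_add_eq_map_conv_map (hZ.measurable_sensorSum s t₀ T) (hZ.measurable _), ih,
      hZ.map_eq, sumLaw]

lemma measure_sensorSum_gt [IsProbabilityMeasure P] (s : S) (t₀ T : ℕ) (b : ℝ) :
    P {ω | b < sensorSum Z s t₀ T ω} = sumLaw (μ s) T (Set.Ioi b) := by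
  rw [← hZ.map_sensorSum s t₀ T, Measure.map_apply (hZ.measurable_sensorSum s t₀ T)
    measurableSet_Ioi]
  rfl

/-- Events determined by different sensors are independent. -/
lemma measure_biInter_sensors [IsProbabilityMeasure P] (A : Finset S) {E : S → Set Ω}
    (hE : ∀ s ∈ A, MeasurableSet[sig Z {p | p.2 = s}] (E s)) :
    P (⋂ s ∈ A, E s) = ∏ s ∈ A, P (E s) := by
  classical
  induction A using Finset.induction_on with
  | empty => simp
  | insert a A ha ih =>
    rw [Finset.set_biInter_insert, Finset.prod_insert ha,
      hZ.measure_inter (J := {p | p.2 = a}) (J' := {p | p.2 ∈ A}) _ (hE a (by simp)),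
      ih fun s hs => hE s (by simp [hs])]
    · refine Finset.measurableSet_biInter A fun s hs => ?_
      refine measurableSet_sig_mono (J := {p : ℕ × S | p.2 = s}) ?_ (hE s (by simp [hs]))
      rintro p rfl
      exact hs
    · rw [Set.disjoint_left]
      rintro p rfl h
      exact ha h

/-- If, starting from time `t₀`, the independent trials `E k` (determined by the `k`-th block of
length `T`) succeed with probability at least `q`, and `D ≤ T (k + 1)` if the trial `k` succeeds,
then `D` has mean at most `T / q`, on every event determined by the past. -/
lemma setLIntegral_le_of_trials [IsProbabilityMeasure P] {t₀ T : ℕ} (hT : 0 < T) {A : Set Ω}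
    (hA : MeasurableSet[sig Z {p | p.1 ≤ t₀}] A) {E : ℕ → Set Ω}
    (hE : ∀ k, MeasurableSet[sig Z {p | t₀ + k * T < p.1 ∧ p.1 ≤ t₀ + (k + 1) * T}] (E k))
    {q : ℝ≥0∞} (hq : ∀ k, q ≤ P (E k)) {D : Ω → ℝ≥0∞}
    (hD : ∀ k, ∀ ω ∈ A ∩ E k, D ω ≤ T * (k + 1)) :
    ∫⁻ ω in A, D ω ∂P ≤ P A * (T / q) := by
  -- `B k` says that the first `k` trials fail. Its probability decays geometrically, and on `A` the
  -- variable `D` is at most `T` times the number of `k` for which `B k` occurs: these are `0, …, k`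
  -- if trial `k` is the first success.
  set B : ℕ → Set Ω := fun k => A ∩ ⋂ j ∈ Finset.range k, (E j)ᶜ with hBdef
  have hBm : ∀ k, MeasurableSet[sig Z {p | p.1 ≤ t₀ + k * T}] (B k) := by
    intro k
    refine MeasurableSet.inter (measurableSet_sig_mono (J := {p : ℕ × S | p.1 ≤ t₀}) ?_ hA)
      (Finset.measurableSet_biInter _ fun j hj => MeasurableSet.compl
        (measurableSet_sig_mono ?_ (hE j)))
    · exact fun p hp => le_trans hp (Nat.le_add_right _ _)
    · refine fun p hp => hp.2.trans ?_
      exact Nat.add_le_add_left (Nat.mul_le_mul_right T (Finset.mem_range.1 hj)) t₀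
  have hBm' : ∀ k, MeasurableSet (B k) := fun k => hZ.sig_le _ _ (hBm k)
  have hEm' : ∀ k, MeasurableSet (E k) := fun k => hZ.sig_le _ _ (hE k)
  have hB : ∀ k, P (B k) ≤ P A * (1 - q) ^ k := by
    intro k
    induction k with
    | zero => simp [hBdef]
    | succ k ih =>
      have h1 : B (k + 1) = B k ∩ (E k)ᶜ := by
        simp only [hBdef, Finset.range_add_one, Finset.set_biInter_insert]
        ext ω
        simp only [Set.mem_inter_iff]
        tauto
      rw [h1, hZ.measure_inter _ (hBm k) (MeasurableSet.compl (hE k)), pow_succ, ← mul_assoc]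
      · refine mul_le_mul' ih ?_
        rw [prob_compl_eq_one_sub (hEm' k)]
        exact tsub_le_tsub_left (hq k) 1
      · exact Set.disjoint_left.2 fun p h h' => absurd h'.1 (not_lt_of_ge h)
  have hq1 : q ≤ 1 := (hq 0).trans prob_le_one
  have hpt : ∀ ω ∈ A, D ω ≤ ∑' k, (B k).indicator (fun _ => (T : ℝ≥0∞)) ω := by
    intro ω hω
    by_cases hex : ∃ k, ω ∈ E k
    · classical
      have hk := Nat.find_spec hex
      have hmin := fun j hj => Nat.find_min hex (m := j) hj
      set k := Nat.find hex
      refine (hD k ω ⟨hω, hk⟩).trans (le_trans ?_ (ENNReal.sum_le_tsum (Finset.range (k + 1))))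
      have : ∀ j ∈ Finset.range (k + 1), (B j).indicator (fun _ => (T : ℝ≥0∞)) ω = T := by
        intro j hj
        refine Set.indicator_of_mem (s := B j) ⟨hω, ?_⟩ _
        simp only [Set.mem_iInter, Finset.mem_range]
        exact fun i hi => hmin i (by have := Finset.mem_range.1 hj; omega)
      rw [Finset.sum_congr rfl this]
      simp [mul_comm]
    · push Not at hex
      have : ∀ j, (B j).indicator (fun _ => (T : ℝ≥0∞)) ω = T := fun j =>
        Set.indicator_of_mem (s := B j) ⟨hω, by simpa using fun i _ => hex i⟩ _
      simp_rw [this]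
      rw [ENNReal.tsum_const_eq_top_of_ne_zero (by simpa using hT.ne')]
      exact le_top
  have hAm : MeasurableSet A := hZ.sig_le _ _ hA
  calc ∫⁻ ω in A, D ω ∂P
      ≤ ∫⁻ ω in A, ∑' k, (B k).indicator (fun _ => (T : ℝ≥0∞)) ω ∂P := setLIntegral_mono' hAm hpt
    _ ≤ ∫⁻ ω, ∑' k, (B k).indicator (fun _ => (T : ℝ≥0∞)) ω ∂P := setLIntegral_le_lintegral _ _
    _ = ∑' k, T * P (B k) := by
      rw [lintegral_tsum fun k => (measurable_const.indicator (hBm' k)).aemeasurable]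
      simp_rw [lintegral_indicator_const (hBm' _)]
    _ ≤ ∑' k, T * (P A * (1 - q) ^ k) := ENNReal.tsum_le_tsum fun k => by gcongr; exact hB k
    _ = P A * (T / q) := by
      rw [ENNReal.tsum_mul_left, ENNReal.tsum_mul_left, ENNReal.tsum_geometric,
        ENNReal.sub_sub_cancel ENNReal.one_ne_top hq1, div_eq_mul_inv]
      ring

end IsSample

/-- The average of a first time is at least of order `1 / q` if the probability that it is at most
`m` is at most `m q`. -/
lemma lintegral_firstTime_ge {Ω : Type*} {mΩ : MeasurableSpace Ω} {P : Measure Ω}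
    [IsProbabilityMeasure P] {p : Ω → ℕ → Prop} (hm : ∀ t, MeasurableSet {ω | p ω t}) {q : ℝ}
    (hq : 0 < q) (hp : ∀ m : ℕ, P {ω | ∃ t ≤ m, p ω t} ≤ ENNReal.ofReal (m * q)) :
    ENNReal.ofReal (1 / (4 * q)) ≤ ∫⁻ ω, firstTime (p ω) ∂P := by
  -- Up to this `m` the event has probability at most `1 / 2`, so the mean is at least `(m + 1) /
  -- 2`, and `m + 1` exceeds `1 / (2 q)`.
  set m : ℕ := ⌊1 / (2 * q)⌋₊ with hmdef
  have hm1 : (m : ℝ) ≤ 1 / (2 * q) := Nat.floor_le (by positivity)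
  have hm2 : 1 / (2 * q) < m + 1 := Nat.lt_floor_add_one _
  have hmq : (m : ℝ) * q ≤ 1 / 2 := by
    calc (m : ℝ) * q ≤ 1 / (2 * q) * q := by gcongr
      _ = 1 / 2 := by field_simp
  set A : Set Ω := {ω | ∃ t ≤ m, p ω t} with hA
  have hAm : MeasurableSet A := by
    have : A = ⋃ (t : ℕ) (_ : t ≤ m), {ω | p ω t} := by ext; simp [hA]
    rw [this]
    exact MeasurableSet.iUnion fun t => MeasurableSet.iUnion fun _ => hm t
  have hAc : ENNReal.ofReal (1 / 2) ≤ P Aᶜ := by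
    rw [prob_compl_eq_one_sub hAm]
    calc ENNReal.ofReal (1 / 2) = 1 - ENNReal.ofReal (1 / 2) := by
          rw [← ENNReal.ofReal_one, ← ENNReal.ofReal_sub _ (by norm_num)]; norm_num
      _ ≤ 1 - P A := tsub_le_tsub_left ((hp m).trans (ENNReal.ofReal_le_ofReal hmq)) 1
  calc ENNReal.ofReal (1 / (4 * q)) ≤ ENNReal.ofReal ((m + 1) * (1 / 2)) := by
        refine ENNReal.ofReal_le_ofReal ?_
        have : 1 / (4 * q) = 1 / (2 * q) * (1 / 2) := by field_simp; norm_num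
        rw [this]; gcongr
    _ = (m + 1 : ℕ) * ENNReal.ofReal (1 / 2) := by
        rw [ENNReal.ofReal_mul (by positivity), ← ENNReal.ofReal_natCast (m + 1)]
        push_cast; rfl
    _ ≤ (m + 1 : ℕ) * P Aᶜ := by gcongr
    _ = ∫⁻ ω, Aᶜ.indicator (fun _ => ((m + 1 : ℕ) : ℝ≥0∞)) ω ∂P := by
        rw [lintegral_indicator_const hAm.compl]
    _ ≤ _ := by
        refine lintegral_mono fun ω => ?_
        refine Set.indicator_apply_le' (fun hω => le_firstTime fun t ht => ?_) fun _ => zero_le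
        simp only [hA, Set.mem_compl_iff, Set.mem_ofPred_eq, not_exists, not_and] at hω
        have : m < t := by
          by_contra h
          exact hω t (not_lt.1 h) ht
        exact_mod_cast this

/-! ### Moments, exponential tails and the maximal inequality for one sensor -/

/-- `μ` has a finite second moment, mean `I` and variance `v`. -/
structure HasMoments (μ : Measure ℝ) (I v : ℝ) : Prop where
  memLp : MemLp id 2 μ
  integral_eq : ∫ x, x ∂μ = I
  integral_sq_eq : ∫ x, (x - I) ^ 2 ∂μ = v

lemma HasMoments.variance_eq {μ : Measure ℝ} {I v : ℝ} (h : HasMoments μ I v) :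
    Var[id; μ] = v := by
  rw [variance_eq_integral aemeasurable_id]
  simp [h.integral_eq, h.integral_sq_eq]

lemma HasMoments.nonneg {μ : Measure ℝ} {I v : ℝ} (h : HasMoments μ I v) : 0 ≤ v := by
  rw [← h.variance_eq]; exact variance_nonneg _ _

lemma isSample_infinitePi {S : Type*} {Ω : ℕ × S → Type*} [∀ p, MeasurableSpace (Ω p)]
    (Q : ∀ p, Measure (Ω p)) [∀ p, IsProbabilityMeasure (Q p)] {X : ∀ p, Ω p → ℝ}
    (hX : ∀ p, Measurable (X p)) {μ : S → Measure ℝ}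
    (hμ : ∀ t s, (Q (t + 1, s)).map (X (t + 1, s)) = μ s) :
    IsSample (fun p (ω : ∀ p, Ω p) => X p (ω p)) μ (Measure.infinitePi Q) where
  measurable p := (hX p).comp (measurable_pi_apply p)
  iIndepFun := iIndepFun_infinitePi hX
  map_eq t s := by
    rw [← hμ, ← Measure.infinitePi_map_eval Q, Measure.map_map (hX _) (measurable_pi_apply _)]
    rfl

namespace IsSample

variable {Ω S : Type*} {mΩ : MeasurableSpace Ω} {P : Measure Ω} [IsProbabilityMeasure P]
  {Z : ℕ × S → Ω → ℝ} {μ : S → Measure ℝ} (hZ : IsSample Z μ P)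
include hZ

/-- Exponential tail of the CUSUM statistic of log-likelihood ratios before the change. -/
lemma measure_sensorCusum_gt_le {s : S} (hs : ∫⁻ x, ENNReal.ofReal (Real.exp x) ∂(μ s) ≤ 1)
    (t : ℕ) :
    ∀ c : ℝ, P {ω | c < max 0 (sensorCusum Z s t ω)} ≤ ENNReal.ofReal (Real.exp (-c)) := by
  -- Negative levels are trivial but must be covered: the induction applies the bound at `c - z`,
  -- where the increment `z` is arbitrary.
  have hneg : ∀ (t : ℕ) (c : ℝ), c < 0 →
      P {ω | c < max 0 (sensorCusum Z s t ω)} ≤ ENNReal.ofReal (Real.exp (-c)) := by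
    intro t c hc
    refine prob_le_one.trans ?_
    rw [ENNReal.one_le_ofReal]
    exact Real.one_le_exp (by linarith)
  induction t with
  | zero =>
    intro c
    rcases lt_or_ge c 0 with hc | hc
    · exact hneg 0 c hc
    · have : {ω : Ω | c < max 0 (sensorCusum Z s 0 ω)} = ∅ := by
        ext ω; simpa [sensorCusum, pathCusum] using hc
      rw [this, measure_empty]
      exact zero_le
  | succ t ih =>
    intro c
    rcases lt_or_ge c 0 with hc | hc
    · exact hneg _ c hc
    set X : Ω → ℝ := fun ω => max 0 (sensorCusum Z s t ω) with hX
    have hXm : Measurable X := measurable_const.max (hZ.measurable_sensorCusum s t)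
    have hXs : Measurable[sig Z {p | p.1 ≤ t}] X :=
      measurable_const.max (measurable_sensorCusum_sig fun r _ h => h)
    have hind : IndepFun X (Z (t + 1, s)) P :=
      hZ.indepFun (J' := {p | t < p.1})
        (Set.disjoint_left.2 fun p (h : p.1 ≤ t) (h' : t < p.1) => by omega)
        hXs (measurable_sig (Nat.lt_succ_self t))
    rw [indepFun_iff_map_prod_eq_prod_map_map hXm.aemeasurable (hZ.measurable _).aemeasurable,
      hZ.map_eq] at hind
    have : IsProbabilityMeasure (μ s) := by
      rw [← hZ.map_eq 0 s]; exact Measure.isProbabilityMeasure_map (hZ.measurable _).aemeasurable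
    have : IsProbabilityMeasure (P.map X) := Measure.isProbabilityMeasure_map hXm.aemeasurable
    have hset : MeasurableSet {p : ℝ × ℝ | c < p.1 + p.2} :=
      measurableSet_lt measurable_const (by fun_prop)
    have h1 : {ω | c < max 0 (sensorCusum Z s (t + 1) ω)} =
        (fun ω => (X ω, Z (t + 1, s) ω)) ⁻¹' {p : ℝ × ℝ | c < p.1 + p.2} := by
      ext ω
      simp only [Set.mem_ofPred_eq, Set.mem_preimage, lt_max_iff, not_lt.2 hc, false_or]
      rfl
    rw [h1, ← Measure.map_apply (hXm.prodMk (hZ.measurable _)) hset, hind,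
      Measure.prod_apply_symm hset]
    -- Given the new increment `z`, the induction hypothesis yields `exp (-c) * exp z`, and `exp z`
    -- has mean at most one.
    calc ∫⁻ z, (P.map X) ((fun x => (x, z)) ⁻¹' {p : ℝ × ℝ | c < p.1 + p.2}) ∂(μ s)
        ≤ ∫⁻ z, ENNReal.ofReal (Real.exp (-c)) * ENNReal.ofReal (Real.exp z) ∂(μ s) := by
          refine lintegral_mono fun z => ?_
          have h2 : (fun x => (x, z)) ⁻¹' {p : ℝ × ℝ | c < p.1 + p.2} = Set.Ioi (c - z) := by
            ext x; simp [sub_lt_iff_lt_add]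
          rw [h2, Measure.map_apply hXm measurableSet_Ioi]
          refine (ih (c - z)).trans (le_of_eq ?_)
          rw [← ENNReal.ofReal_mul (Real.exp_pos _).le, ← Real.exp_add]
          congr 2; ring
      _ ≤ ENNReal.ofReal (Real.exp (-c)) := by
          rw [lintegral_const_mul _ (by fun_prop)]
          exact mul_le_of_le_one_right' hs

omit [IsProbabilityMeasure P] in
lemma memLp {s : S} {I v : ℝ} (hs : HasMoments (μ s) I v) (t : ℕ) : MemLp (Z (t + 1, s)) 2 P := by
  have h := hs.memLp
  rw [← hZ.map_eq t s, memLp_map_measure_iff aestronglyMeasurable_id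
    (hZ.measurable _).aemeasurable] at h
  exact h

lemma memLp_centered {s : S} {I v : ℝ} (hs : HasMoments (μ s) I v) (i : ℕ) :
    MemLp (fun ω => sensorSum Z s 0 i ω - I * i) 2 P := by
  have h : MemLp (sensorSum Z s 0 i) 2 P :=
    memLp_finsetSum (f := fun j => Z (0 + j + 1, s)) (Finset.range i) fun j _ => hZ.memLp hs _
  exact h.sub (memLp_const _)

/-- The cross term vanishes because the next centred increment is independent of `A` and of the past
sum. One identity thus serves both the variance formula and the submartingale property behind the
maximal inequality. -/
lemma setIntegral_centered_sq_succ {s : S} {I v : ℝ} (hs : HasMoments (μ s) I v) (i : ℕ)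
    {A : Set Ω} (hA : MeasurableSet[sig Z {p | p.1 ≤ i}] A) :
    ∫ ω in A, (sensorSum Z s 0 (i + 1) ω - I * (i + 1 : ℕ)) ^ 2 ∂P =
      ∫ ω in A, (sensorSum Z s 0 i ω - I * i) ^ 2 ∂P +
        ∫ ω in A, (Z (i + 1, s) ω - I) ^ 2 ∂P := by
  have hAm : MeasurableSet A := hZ.sig_le _ _ hA
  set R : Ω → ℝ := fun ω => sensorSum Z s 0 i ω - I * i with hR
  set X : Ω → ℝ := fun ω => Z (i + 1, s) ω - I with hX
  have hRL : MemLp R 2 P := hZ.memLp_centered hs i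
  have hXL : MemLp X 2 P := (hZ.memLp hs i).sub (memLp_const I)
  have hsum : ∀ ω, (sensorSum Z s 0 (i + 1) ω - I * (i + 1 : ℕ)) ^ 2 =
      R ω ^ 2 + X ω ^ 2 + 2 * (R ω * X ω) := by
    intro ω
    simp only [hR, hX, sensorSum, blockSum_succ, zero_add]
    push_cast; ring
  have hRXsq : Integrable (fun ω => R ω ^ 2 + X ω ^ 2) P := hRL.integrable_sq.add hXL.integrable_sq
  have hRX : Integrable (fun ω => R ω * X ω) P := hRL.integrable_mul hXL
  have hAR : Measurable[sig Z {p | p.1 ≤ i}] (A.indicator R) := by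
    refine Measurable.indicator (Measurable.sub_const ?_ _) hA
    exact measurable_sensorSum_sig fun t _ h => by simpa using h
  have hXs : Measurable[sig Z {p | i < p.1}] X :=
    Measurable.sub_const (measurable_sig (p := (i + 1, s)) (Nat.lt_succ_self i)) _
  have hind : IndepFun (A.indicator R) X P :=
    hZ.indepFun (Set.disjoint_left.2 fun p (h : p.1 ≤ i) (h' : i < p.1) => by omega) hAR hXs
  have hX0 : ∫ ω, X ω ∂P = 0 := by
    rw [hX, integral_sub ((hZ.memLp hs i).integrable (by norm_num)) (integrable_const _)]
    have : ∫ ω, Z (i + 1, s) ω ∂P = I := by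
      rw [← hs.integral_eq, ← hZ.map_eq i s,
        integral_map (hZ.measurable _).aemeasurable (f := fun x => x)
        aestronglyMeasurable_id]
    simp [this]
  have hzero : ∫ ω in A, R ω * X ω ∂P = 0 := by
    rw [← integral_indicator hAm]
    have : (A.indicator fun ω => R ω * X ω) = fun ω => A.indicator R ω * X ω := by
      ext ω; by_cases h : ω ∈ A <;> simp [h]
    rw [this]
    have h := hind.integral_mul_eq_mul_integral
      (hAR.mono (hZ.sig_le _) le_rfl).aestronglyMeasurable
      (hXs.mono (hZ.sig_le _) le_rfl).aestronglyMeasurable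
    simp only [Pi.mul_apply] at h
    rw [h, hX0, mul_zero]
  simp_rw [hsum]
  rw [integral_add (f := fun ω => R ω ^ 2 + X ω ^ 2) (g := fun ω => 2 * (R ω * X ω))
      hRXsq.integrableOn
      (hRX.const_mul 2).integrableOn,
    integral_add hRL.integrable_sq.integrableOn hXL.integrable_sq.integrableOn,
    integral_const_mul, hzero, mul_zero, add_zero]

lemma integral_centered_sq {s : S} {I v : ℝ} (hs : HasMoments (μ s) I v) (i : ℕ) :
    ∫ ω, (sensorSum Z s 0 i ω - I * i) ^ 2 ∂P = i * v := by
  induction i with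
  | zero => simp [sensorSum, blockSum]
  | succ i ih =>
    have h := hZ.setIntegral_centered_sq_succ hs i (A := Set.univ) MeasurableSet.univ
    simp only [Measure.restrict_univ] at h
    rw [h, ih]
    have : ∫ ω, (Z (i + 1, s) ω - I) ^ 2 ∂P = v := by
      rw [← hs.integral_sq_eq, ← hZ.map_eq i s, integral_map (hZ.measurable _).aemeasurable
        (by fun_prop)]
    rw [this]; push_cast; ring

/-- Kolmogorov's maximal inequality. -/
lemma measure_exists_le_abs_centered {s : S} {I v : ℝ} (hs : HasMoments (μ s) I v) (t : ℕ)
    {c : ℝ} (hc : 0 < c) :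
    P {ω | ∃ i ≤ t, c ≤ |sensorSum Z s 0 i ω - I * i|} ≤ ENNReal.ofReal (t * v / c ^ 2) := by
  let 𝒢 : Filtration ℕ mΩ :=
    { seq := fun i => sig Z {p | p.1 ≤ i}
      mono' := fun i j hij A hA => measurableSet_sig_mono (fun p hp => le_trans hp hij) hA
      le' := fun i => hZ.sig_le _ }
  set f : ℕ → Ω → ℝ := fun i ω => (sensorSum Z s 0 i ω - I * i) ^ 2 with hf
  have hsub : Submartingale f 𝒢 P := by
    refine submartingale_of_setIntegral_le_succ (fun i => ?_)
      (fun i => (hZ.memLp_centered hs i).integrable_sq) fun i A hA => ?_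
    · have h : Measurable[𝒢 i] (sensorSum Z s 0 i) :=
        measurable_sensorSum_sig fun t _ h => by simpa using h
      exact Measurable.stronglyMeasurable ((h.sub_const _).pow_const 2)
    · simp only [hf]
      rw [hZ.setIntegral_centered_sq_succ hs i hA]
      exact le_add_of_nonneg_right (integral_nonneg fun ω => sq_nonneg _)
  have h := maximal_ineq hsub (fun i ω => sq_nonneg _) (ε := (c ^ 2).toNNReal) t
  have hset : {ω | ∃ i ≤ t, c ≤ |sensorSum Z s 0 i ω - I * i|} =
      {ω | ((c ^ 2).toNNReal : ℝ) ≤ (Finset.range (t + 1)).sup' Finset.nonempty_range_add_one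
        fun k => f k ω} := by
    ext ω
    simp only [Set.mem_ofPred_eq, Finset.le_sup'_iff, Finset.mem_range, Nat.lt_succ_iff,
      Real.coe_toNNReal _ (sq_nonneg c), hf]
    refine exists_congr fun i => and_congr_right fun _ => ?_
    rw [← sq_abs (sensorSum Z s 0 i ω - I * i)]
    exact (pow_le_pow_iff_left₀ hc.le (abs_nonneg _) two_ne_zero).symm
  rw [← hset] at h
  have h2 : ENNReal.ofReal (c ^ 2) * P {ω | ∃ i ≤ t, c ≤ |sensorSum Z s 0 i ω - I * i|} ≤
      ENNReal.ofReal (t * v) := by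
    refine h.trans (ENNReal.ofReal_le_ofReal ?_)
    rw [← hZ.integral_centered_sq hs t]
    exact setIntegral_le_integral (hZ.memLp_centered hs t).integrable_sq
      (Eventually.of_forall fun ω => sq_nonneg _)
  rw [ENNReal.ofReal_div_of_pos (by positivity), ENNReal.le_div_iff_mul_le
    (Or.inl (by simpa using hc.ne')) (Or.inl ENNReal.ofReal_ne_top), mul_comm]
  exact h2

/-- With probability close to one the CUSUM statistic stays below its drift plus `2 c`. -/
lemma measure_exists_sensorCusum_gt_le {s : S} {I v : ℝ} (hs : HasMoments (μ s) I v) (hI : 0 ≤ I)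
    (t : ℕ) {b c : ℝ} (hc : 0 < c) (hb : I * t + 2 * c ≤ b) :
    P {ω | ∃ r ≤ t, b < sensorCusum Z s r ω} ≤ ENNReal.ofReal (t * v / c ^ 2) := by
  refine (measure_mono fun ω hω => ?_).trans (hZ.measure_exists_le_abs_centered hs t hc)
  obtain ⟨r, hr, hrb⟩ := hω
  by_contra hcon
  simp only [Set.mem_ofPred_eq, not_exists, not_and, not_le] at hcon
  have := pathCusum_le_of_blockSum_bound (ζ := fun t => Z (t, s) ω) hI
    (fun i hi => (hcon i hi).le) hr
  have h2 : b < pathCusum (fun t => Z (t, s) ω) r := hrb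
  linarith

end IsSample

/-! ### Fluctuations of sums of independent variables -/

section SumLaw

variable {μ : Measure ℝ} [IsProbabilityMeasure μ] {I v : ℝ}

/-- A canonical one-sensor sample, which lets path inequalities and the central limit theorem be
read as statements about `sumLaw`. -/
lemma isSample_unit (μ : Measure ℝ) [IsProbabilityMeasure μ] :
    IsSample (fun p (ω : ℕ × Unit → ℝ) => ω p) (fun _ => μ)
      (Measure.infinitePi fun _ : ℕ × Unit => μ) :=
  isSample_infinitePi (S := Unit) (Ω := fun _ => ℝ) (fun _ => μ) (X := fun _ x => x)
    (fun _ => measurable_id) (μ := fun _ => μ) fun _ _ => Measure.map_id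

lemma sumLaw_Iic_le (hμ : HasMoments μ I v) (T : ℕ) {b : ℝ} (hb : b < I * T) :
    sumLaw μ T (Set.Iic b) ≤ ENNReal.ofReal (T * v / (I * T - b) ^ 2) := by
  have hZ := isSample_unit μ
  rw [← hZ.map_sensorSum () 0 T, Measure.map_apply (hZ.measurable_sensorSum _ _ _)
    measurableSet_Iic]
  refine (measure_mono fun ω hω => ?_).trans
    (hZ.measure_exists_le_abs_centered (s := ()) hμ T (sub_pos.2 hb))
  refine ⟨T, le_rfl, ?_⟩
  have h : sensorSum (fun p (ω : ℕ × Unit → ℝ) => ω p) () 0 T ω ≤ b := hω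
  rw [abs_sub_comm]
  exact le_trans (by linarith) (le_abs_self _)

/-- By the central limit theorem, the normalized sum lies in a given interval with probability
bounded below. -/
lemma exists_le_sumLaw_Ioo (hμ : HasMoments μ I v) (hv : v ≠ 0) {a b : ℝ} (hab : a < b) :
    ∃ c : ℝ, 0 < c ∧ ∀ᶠ T : ℕ in atTop,
      ENNReal.ofReal c ≤ sumLaw μ T (Set.Ioo (I * T + a * √T) (I * T + b * √T)) := by
  have hZ := isSample_unit μ
  set P := Measure.infinitePi fun _ : ℕ × Unit => μ
  set X : ℕ → (ℕ × Unit → ℝ) → ℝ := fun k ω => ω (k + 1, ()) with hX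
  have hXm : ∀ k, Measurable (X k) := fun k => hZ.measurable (k + 1, ())
  have hlaw : ∀ k, P.map (X k) = μ := fun k => hZ.map_eq k ()
  have hmean : ∫ ω, X 0 ω ∂P = I := by
    rw [← hμ.integral_eq]
    conv_rhs => rw [← hlaw 0]
    rw [integral_map (hXm 0).aemeasurable (f := fun x => x) aestronglyMeasurable_id]
  have hvar : Var[X 0; P] = v := by
    rw [← hμ.variance_eq]
    conv_rhs => rw [← hlaw 0]
    rw [variance_map aemeasurable_id (hXm 0).aemeasurable]; rfl
  have hclt := tendstoInDistribution_inv_sqrt_mul_sum_sub (P := P) (X := X) (Y := id)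
    (P' := gaussianReal 0 Var[X 0; P].toNNReal) ⟨aemeasurable_id, Measure.map_id⟩
    (hZ.memLp hμ 0)
    (hZ.iIndepFun.precomp (g := fun k : ℕ => (k + 1, ())) fun i j h => by simpa using h)
    (fun i => ⟨(hXm i).aemeasurable, (hXm 0).aemeasurable, by rw [hlaw, hlaw]⟩)
  -- Portmanteau for an open interval: its limiting mass is positive since the Gaussian is
  -- nondegenerate, and half of that mass is a valid eventual lower bound.
  have hlim := ProbabilityMeasure.le_liminf_measure_open_of_tendsto hclt.tendsto
    (isOpen_Ioo (a := a) (b := b))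
  simp only [ProbabilityMeasure.coe_mk, Measure.map_id] at hlim
  have hpos : 0 < gaussianReal 0 Var[X 0; P].toNNReal (Set.Ioo a b) := by
    rw [pos_iff_ne_zero]
    intro h0
    have hv' : Var[X 0; P].toNNReal ≠ 0 := by
      rw [hvar]; simpa using lt_of_le_of_ne hμ.nonneg hv.symm
    have := gaussianReal_absolutelyContinuous' 0 hv' h0
    simp [hab.not_ge] at this
  set w := gaussianReal 0 Var[X 0; P].toNNReal (Set.Ioo a b)
  have hwtop : w ≠ ⊤ := measure_ne_top _ _
  have hw' : 0 < w.toReal := ENNReal.toReal_pos hpos.ne' hwtop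
  refine ⟨w.toReal / 2, by positivity, ?_⟩
  have hlt : ENNReal.ofReal (w.toReal / 2) < w := by
    rw [ENNReal.ofReal_lt_iff_lt_toReal (by positivity) hwtop]; linarith
  filter_upwards [eventually_lt_of_lt_liminf (hlt.trans_le hlim), eventually_gt_atTop 0]
    with T hT hT0
  refine hT.le.trans ?_
  rw [← hZ.map_sensorSum () 0 T, Measure.map_apply (hZ.measurable_sensorSum _ _ _)
    measurableSet_Ioo, Measure.map_apply_of_aemeasurable (hclt.forall_aemeasurable T)
    measurableSet_Ioo]
  refine measure_mono fun ω hω => ?_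
  have hsq : 0 < √(T : ℝ) := Real.sqrt_pos.2 (by exact_mod_cast hT0)
  have hsum : ∑ k ∈ Finset.range T, X k ω =
      sensorSum (fun p (ω : ℕ × Unit → ℝ) => ω p) () 0 T ω := by
    simp [sensorSum, blockSum, hX]
  simp only [Set.mem_preimage, Set.mem_Ioo, hmean, hsum, inv_mul_eq_div, lt_div_iff₀ hsq,
    div_lt_iff₀ hsq] at hω ⊢
  constructor <;> nlinarith [hω.1, hω.2]

end SumLaw

lemma exists_firstTime_eq {p : ℕ → Prop} (h : ∃ t, p t) :
    ∃ t, p t ∧ (∀ r < t, ¬ p r) ∧ firstTime p = t := by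
  classical
  refine ⟨Nat.find h, Nat.find_spec h, fun r hr => Nat.find_min h hr, le_antisymm
    (firstTime_le (Nat.find_spec h)) (le_firstTime fun t ht => ?_)⟩
  exact_mod_cast Nat.find_min' h ht

lemma firstTime_eq_top {p : ℕ → Prop} (h : ¬ ∃ t, p t) : firstTime p = ⊤ :=
  top_le_iff.1 (le_firstTime fun t ht => absurd ⟨t, ht⟩ h)

/-! ### Crossing times and the two rules: pathwise comparison and non-asymptotic bounds -/

section Rules

variable {Ω S : Type*} {mΩ : MeasurableSpace Ω} {P : Measure Ω}
  {Z : ℕ × S → Ω → ℝ} {μ : S → Measure ℝ}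

/-- The first time at which the CUSUM statistic of sensor `s` exceeds `b`. -/
noncomputable def crossTime (Z : ℕ × S → Ω → ℝ) (s : S) (b : ℝ) (ω : Ω) : ℝ≥0∞ :=
  firstTime fun t => b < sensorCusum Z s t ω

/-- The `M`-th alarm rule with threshold `b s` at sensor `s`. -/
noncomputable def alarmTime (Z : ℕ × S → Ω → ℝ) (M : ℕ) (b : S → ℝ) (ω : Ω) : ℝ≥0∞ :=
  firstTime fun t => M ≤ {s | ∃ r ≤ t, b s < sensorCusum Z s r ω}.ncard

/-- The `M` voting rule with threshold `b s` at sensor `s`. -/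
noncomputable def voteTime (Z : ℕ × S → Ω → ℝ) (M : ℕ) (b : S → ℝ) (ω : Ω) : ℝ≥0∞ :=
  firstTime fun t => M ≤ {s | b s < sensorCusum Z s t ω}.ncard

lemma alarmTime_mono [Finite S] {M M' : ℕ} (hM : M ≤ M') {b b' : S → ℝ} (hb : ∀ s, b s ≤ b' s)
    (ω : Ω) : alarmTime Z M b ω ≤ alarmTime Z M' b' ω :=
  firstTime_anti fun _ ht => hM.trans (ht.trans (Set.ncard_le_ncard
    (fun s ⟨r, hr, h⟩ => ⟨r, hr, (hb s).trans_lt h⟩) (Set.toFinite _)))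

lemma voteTime_mono [Finite S] {M M' : ℕ} (hM : M ≤ M') {b b' : S → ℝ} (hb : ∀ s, b s ≤ b' s)
    (ω : Ω) : voteTime Z M b ω ≤ voteTime Z M' b' ω :=
  firstTime_anti fun _ ht => hM.trans (ht.trans (Set.ncard_le_ncard
    (fun s (h : b' s < _) => (hb s).trans_lt h) (Set.toFinite _)))

lemma alarmTime_le_voteTime [Finite S] (M : ℕ) (b : S → ℝ) (ω : Ω) :
    alarmTime Z M b ω ≤ voteTime Z M b ω :=
  firstTime_anti fun t ht => ht.trans (Set.ncard_le_ncard
    (fun _ h => ⟨t, le_rfl, h⟩) (Set.toFinite _))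

lemma alarmTime_le [Fintype S] {A : Finset S} {M : ℕ} (hM : A.card = M) {b : S → ℝ} {ω : Ω}
    {a : ℝ≥0∞} (ha : ∀ s ∈ A, crossTime Z s (b s) ω ≤ a) : alarmTime Z M b ω ≤ a := by
  rcases eq_or_ne a ⊤ with rfl | hat
  · exact le_top
  have h1 : ∀ s ∈ A, ∃ r ≤ ⌊a.toReal⌋₊, b s < sensorCusum Z s r ω := by
    intro s hs
    by_cases hex : ∃ t, b s < sensorCusum Z s t ω
    · obtain ⟨t, ht, -, heq⟩ := exists_firstTime_eq hex
      refine ⟨t, Nat.le_floor ?_, ht⟩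
      have h2 : (t : ℝ≥0∞) ≤ a := heq ▸ ha s hs
      simpa using (ENNReal.toReal_le_toReal (ENNReal.natCast_ne_top t) hat).2 h2
    · have h2 := ha s hs
      rw [crossTime, firstTime_eq_top hex, top_le_iff] at h2
      exact absurd h2 hat
  refine (firstTime_le (t := ⌊a.toReal⌋₊) (le_ncard_iff.2 ⟨A, hM, h1⟩)).trans ?_
  rw [← ENNReal.ofReal_natCast]
  exact (ENNReal.ofReal_le_ofReal (Nat.floor_le ENNReal.toReal_nonneg)).trans
    ENNReal.ofReal_toReal_le

/-- The event that the CUSUM statistic of sensor `s` has exceeded `b`, but not yet `b'`. -/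
def betweenSet (Z : ℕ × S → Ω → ℝ) (s : S) (b b' : ℝ) (i : ℕ) : Set Ω :=
  {ω | (∃ r ≤ i, b < sensorCusum Z s r ω) ∧ ∀ r ≤ i, sensorCusum Z s r ω ≤ b'}

open Classical in
lemma crossTime_le_add (s : S) (b b' : ℝ) (ω : Ω) :
    crossTime Z s b' ω ≤
      crossTime Z s b ω + ∑' i, (betweenSet Z s b b' i).indicator (fun _ => (1 : ℝ≥0∞)) ω := by
  by_cases hex : ∃ t, b < sensorCusum Z s t ω
  swap
  · rw [crossTime, crossTime, firstTime_eq_top hex, top_add]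
    exact le_top
  obtain ⟨t, ht, -, heq⟩ := exists_firstTime_eq hex
  have key : ∀ m : ℕ, (∀ r < m, sensorCusum Z s r ω ≤ b') → (m : ℝ≥0∞) ≤
      t + ∑' i, (betweenSet Z s b b' i).indicator (fun _ => (1 : ℝ≥0∞)) ω := by
    intro m hm
    have h1 : ((m - t : ℕ) : ℝ≥0∞) ≤
        ∑' i, (betweenSet Z s b b' i).indicator (fun _ => (1 : ℝ≥0∞)) ω := by
      refine le_trans (le_of_eq ?_) (ENNReal.sum_le_tsum (Finset.Ico t m))
      rw [Finset.sum_congr rfl (g := fun _ => (1 : ℝ≥0∞))]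
      · simp
      · intro i hi
        rw [Finset.mem_Ico] at hi
        exact Set.indicator_of_mem (s := betweenSet Z s b b' i)
          ⟨⟨t, hi.1, ht⟩, fun r hr => hm r (by omega)⟩ _
    calc (m : ℝ≥0∞) ≤ ((t + (m - t) : ℕ) : ℝ≥0∞) := by exact_mod_cast (by omega)
      _ ≤ _ := by rw [Nat.cast_add]; gcongr
  rw [crossTime, crossTime, heq]
  by_cases hex' : ∃ t, b' < sensorCusum Z s t ω
  · obtain ⟨t', -, hmin, heq'⟩ := exists_firstTime_eq hex'
    rw [heq']
    exact key t' fun r hr => not_lt.1 (hmin r hr)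
  · push Not at hex'
    rw [ENNReal.eq_top_of_forall_nnreal_le (x := (t : ℝ≥0∞) + _) fun r => ?_]
    · exact le_top
    · obtain ⟨m, hm⟩ := exists_nat_ge r
      exact le_trans (by exact_mod_cast hm) (key m fun r _ => hex' r)

/-- The `M` sensors that stopped the rule at the lower thresholds also stop it at the higher ones
after their own additional waits, and the sum over all sensors dominates the longest of these. -/
lemma alarmTime_le_add [Fintype S] (M : ℕ) (b b' : S → ℝ) (ω : Ω) :
    alarmTime Z M b' ω ≤ alarmTime Z M b ω +
      ∑ s, ∑' i, (betweenSet Z s (b s) (b' s) i).indicator (fun _ => (1 : ℝ≥0∞)) ω := by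
  by_cases hex : ∃ t, M ≤ {s | ∃ r ≤ t, b s < sensorCusum Z s r ω}.ncard
  swap
  · rw [alarmTime, alarmTime, firstTime_eq_top hex, top_add]
    exact le_top
  obtain ⟨t, ht, -, heq⟩ := exists_firstTime_eq hex
  obtain ⟨A, hA, hAs⟩ := le_ncard_iff.1 ht
  rw [alarmTime.eq_1 Z M b, heq]
  refine alarmTime_le hA fun s hs => (crossTime_le_add s (b s) (b' s) ω).trans ?_
  obtain ⟨r, hr, hrb⟩ := hAs s hs
  refine add_le_add ((firstTime_le hrb).trans (by exact_mod_cast hr)) ?_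
  exact Finset.single_le_sum (f := fun s => ∑' i, (betweenSet Z s (b s) (b' s) i).indicator
    (fun _ => (1 : ℝ≥0∞)) ω) (fun _ _ => zero_le) (Finset.mem_univ s)

open Classical in
/-- The truncated increments between the first times above `b` and above `b'` sum up to at most
`b' - b + K`. -/
lemma sum_betweenSet_le (s : S) {b b' K : ℝ} (hb : b ≤ b') (hK : 0 ≤ K) (ω : Ω) (n : ℕ) :
    ∑ i ∈ Finset.range n, (betweenSet Z s b b' i).indicator
      (fun ω => min (Z (i + 1, s) ω) K) ω ≤ b' - b + K := by
  set U : ℕ → ℝ := fun n => ∑ i ∈ Finset.range n, (betweenSet Z s b b' i).indicator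
      (fun ω => min (Z (i + 1, s) ω) K) ω with hU
  have hsucc : ∀ n, U (n + 1) = U n + (betweenSet Z s b b' n).indicator
      (fun ω => min (Z (n + 1, s) ω) K) ω := fun n => Finset.sum_range_succ _ _
  -- The induction follows three phases: before crossing `b` nothing has been counted; between the
  -- levels the counted increments stay below the climb of the statistic; after crossing `b'` the
  -- sum is frozen, and its last term contributes at most the truncation level `K`.
  have key : ((∀ r ≤ n, sensorCusum Z s r ω ≤ b) → U n = 0) ∧
      (ω ∈ betweenSet Z s b b' n → b + U n ≤ sensorCusum Z s n ω) ∧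
      ((∃ r ≤ n, b' < sensorCusum Z s r ω) → U n ≤ b' - b + K) := by
    induction n with
    | zero =>
      have h0 : U 0 = 0 := by simp [hU]
      refine ⟨fun _ => h0, ?_, fun _ => by rw [h0]; linarith⟩
      rintro ⟨⟨r, hr, h⟩, -⟩
      obtain rfl : r = 0 := by omega
      linarith
    | succ n ih =>
      obtain ⟨ih1, ih2, ih3⟩ := ih
      by_cases h1 : ∀ r ≤ n, sensorCusum Z s r ω ≤ b
      · have hn : ω ∉ betweenSet Z s b b' n := by
          rintro ⟨⟨r, hr, h⟩, -⟩
          exact absurd (h1 r hr) (not_le.2 h)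
        have h0 : U (n + 1) = 0 := by rw [hsucc, ih1 h1, Set.indicator_of_notMem hn, add_zero]
        refine ⟨fun _ => h0, ?_, fun _ => by rw [h0]; linarith⟩
        rintro ⟨⟨r, hr, h⟩, -⟩
        obtain rfl : r = n + 1 := by
          by_contra hne
          exact absurd (h1 r (by omega)) (not_le.2 h)
        linarith
      · push Not at h1
        obtain ⟨r₀, hr₀, hb₀⟩ := h1
        refine ⟨fun h => absurd (h r₀ (by omega)) (not_le.2 hb₀), ?_, ?_⟩
        · rintro ⟨-, h⟩
          have hn : ω ∈ betweenSet Z s b b' n := ⟨⟨r₀, hr₀, hb₀⟩, fun r hr => h r (by omega)⟩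
          rw [hsucc, Set.indicator_of_mem hn]
          have h2 := ih2 hn
          have h3 : sensorCusum Z s (n + 1) ω = max 0 (sensorCusum Z s n ω) + Z (n + 1, s) ω := rfl
          rw [h3]
          linarith [min_le_left (Z (n + 1, s) ω) K, le_max_right 0 (sensorCusum Z s n ω)]
        · intro _
          by_cases hn : ω ∈ betweenSet Z s b b' n
          · rw [hsucc, Set.indicator_of_mem hn]
            have h2 := ih2 hn
            have h3 := hn.2 n le_rfl
            linarith [min_le_right (Z (n + 1, s) ω) K]
          · rw [hsucc, Set.indicator_of_notMem hn, add_zero]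
            refine ih3 ?_
            by_contra hcon
            push Not at hcon
            exact hn ⟨⟨r₀, hr₀, hb₀⟩, hcon⟩
  obtain ⟨k1, k2, k3⟩ := key
  by_cases h1 : ∀ r ≤ n, sensorCusum Z s r ω ≤ b
  · have := k1 h1
    change U n ≤ _
    linarith
  by_cases h2 : ∃ r ≤ n, b' < sensorCusum Z s r ω
  · exact k3 h2
  · push Not at h1 h2
    have := k2 ⟨h1, h2⟩
    have := h2 n le_rfl
    change U n ≤ _
    linarith

omit mΩ in
lemma measurableSet_exists_gt (s : S) (b : ℝ) (t : ℕ) :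
    MeasurableSet[sig Z {p | p.1 ≤ t ∧ p.2 = s}] {ω | ∃ r ≤ t, b < sensorCusum Z s r ω} := by
  have : {ω | ∃ r ≤ t, b < sensorCusum Z s r ω} =
      ⋃ (r : ℕ) (_ : r ≤ t), {ω | b < sensorCusum Z s r ω} := by ext; simp
  rw [this]
  refine MeasurableSet.iUnion fun r => MeasurableSet.iUnion fun hr => ?_
  have h : Measurable[sig Z {p | p.1 ≤ t ∧ p.2 = s}] (sensorCusum Z s r) :=
    measurable_sensorCusum_sig fun i _ h => ⟨h.trans hr, rfl⟩
  exact h measurableSet_Ioi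

omit mΩ in
lemma measurableSet_betweenSet (s : S) (b b' : ℝ) (i : ℕ) :
    MeasurableSet[sig Z {p | p.1 ≤ i}] (betweenSet Z s b b' i) := by
  have h1 := measurableSet_sig_mono (J' := {p : ℕ × S | p.1 ≤ i}) (fun p hp => hp.1)
    (measurableSet_exists_gt (Z := Z) s b i)
  have h2 := measurableSet_sig_mono (J' := {p : ℕ × S | p.1 ≤ i}) (fun p hp => hp.1)
    (measurableSet_exists_gt (Z := Z) s b' i)
  have : betweenSet Z s b b' i = {ω | ∃ r ≤ i, b < sensorCusum Z s r ω} ∩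
      {ω | ∃ r ≤ i, b' < sensorCusum Z s r ω}ᶜ := by
    ext; simp [betweenSet]
  rw [this]
  exact h1.inter h2.compl

namespace IsSample

variable (hZ : IsSample Z μ P)
include hZ

lemma measurable_alarmTime [Fintype S] (M : ℕ) (b : S → ℝ) : Measurable (alarmTime Z M b) :=
  measurable_firstTime fun t => measurableSet_le_ncard fun s =>
    hZ.sig_le _ _ (measurableSet_exists_gt s (b s) t)

variable [IsProbabilityMeasure P]

/-- Raising the threshold of a sensor with positive drift by `a` delays its alarm by at most
`O(a + 1)` on average. -/
lemma lintegral_tsum_betweenSet_le {s : S} {K m : ℝ} (hK : 0 ≤ K) (hm : 0 < m)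
    (hint : Integrable id (μ s)) (hKm : ∫ x, min x K ∂(μ s) = m) {b b' : ℝ} (hb : b ≤ b') :
    ∫⁻ ω, ∑' i, (betweenSet Z s b b' i).indicator (fun _ => (1 : ℝ≥0∞)) ω ∂P ≤
      ENNReal.ofReal ((b' - b + K) / m) := by
  have hB : ∀ i, MeasurableSet (betweenSet Z s b b' i) := fun i =>
    hZ.sig_le _ _ (measurableSet_betweenSet s b b' i)
  have hZint : ∀ i, Integrable (Z (i + 1, s)) P := by
    intro i
    rw [← hZ.map_eq i s] at hint
    exact (integrable_map_measure aestronglyMeasurable_id (hZ.measurable _).aemeasurable).1 hint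
  have hXint : ∀ i, Integrable (fun ω => min (Z (i + 1, s) ω) K) P := fun i =>
    (hZint i).inf (integrable_const K)
  have hmean : ∀ i, ∫ ω, min (Z (i + 1, s) ω) K ∂P = m := by
    intro i
    rw [← hKm, ← hZ.map_eq i s, integral_map (hZ.measurable _).aemeasurable
      (f := fun x => min x K) (by fun_prop)]
  have hone : ∀ i, ∫ ω, (betweenSet Z s b b' i).indicator
      (fun ω => min (Z (i + 1, s) ω) K) ω ∂P = P.real (betweenSet Z s b b' i) * m := by
    intro i
    have h1 : Measurable[sig Z {p | p.1 ≤ i}]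
        ((betweenSet Z s b b' i).indicator fun _ => (1 : ℝ)) :=
      measurable_const.indicator (measurableSet_betweenSet s b b' i)
    have h2 : Measurable[sig Z {p | i < p.1}] fun ω => min (Z (i + 1, s) ω) K :=
      (measurable_sig (p := (i + 1, s)) (Nat.lt_succ_self i)).min measurable_const
    -- This is Wald's argument: whether time `i` is counted depends only on observations up to `i`,
    -- so the next truncated increment contributes its full mean `m`.
    have hind := hZ.indepFun
      (Set.disjoint_left.2 fun p (h : p.1 ≤ i) (h' : i < p.1) => by omega) h1 h2
    have h := hind.integral_mul_eq_mul_integral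
      (h1.mono (hZ.sig_le _) le_rfl).aestronglyMeasurable
      (h2.mono (hZ.sig_le _) le_rfl).aestronglyMeasurable
    rw [hmean, integral_indicator_const _ (hB i), smul_eq_mul, mul_one] at h
    rw [← h]
    refine integral_congr_ae (Eventually.of_forall fun ω => ?_)
    by_cases hω : ω ∈ betweenSet Z s b b' i <;> simp [hω]
  have hsum : ∀ n, ∑ i ∈ Finset.range n, P.real (betweenSet Z s b b' i) ≤ (b' - b + K) / m := by
    intro n
    rw [le_div_iff₀ hm, Finset.sum_mul, ← Finset.sum_congr rfl fun i _ => hone i,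
      ← integral_finsetSum _ fun i _ => (hXint i).indicator (hB i)]
    calc _ ≤ ∫ _, (b' - b + K) ∂P :=
          integral_mono (integrable_finsetSum _ fun i _ => (hXint i).indicator (hB i))
            (integrable_const _) fun ω => sum_betweenSet_le s hb hK ω n
      _ = _ := by simp
  rw [lintegral_tsum fun i => (measurable_const.indicator (hB i)).aemeasurable,
    ENNReal.tsum_eq_iSup_nat]
  refine iSup_le fun n => ?_
  simp_rw [lintegral_indicator_const (hB _), one_mul]
  calc ∑ i ∈ Finset.range n, P (betweenSet Z s b b' i)
      = ENNReal.ofReal (∑ i ∈ Finset.range n, P.real (betweenSet Z s b b' i)) := by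
        rw [ENNReal.ofReal_sum_of_nonneg fun _ _ => measureReal_nonneg]
        simp
    _ ≤ _ := ENNReal.ofReal_le_ofReal (hsum n)

/-- Consecutive blocks of length `T` are independent trials: a block sum above `b` forces the
statistic above `b` at the end of the block. -/
lemma lintegral_crossTime_le (s : S) (b : ℝ) {T : ℕ} (hT : 0 < T) :
    ∫⁻ ω, crossTime Z s b ω ∂P ≤ T / sumLaw (μ s) T (Set.Ioi b) := by
  have h := hZ.setLIntegral_le_of_trials (t₀ := 0) hT (A := Set.univ) MeasurableSet.univ
    (E := fun k => {ω | b < sensorSum Z s (k * T) T ω}) (q := sumLaw (μ s) T (Set.Ioi b))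
    (D := crossTime Z s b) (fun k => ?_) (fun k => (hZ.measure_sensorSum_gt s _ T b).ge)
    fun k ω hω => ?_
  · simpa using h
  · have h : Measurable[sig Z {p | 0 + k * T < p.1 ∧ p.1 ≤ 0 + (k + 1) * T}]
        (sensorSum Z s (k * T) T) :=
      measurable_sensorSum_sig fun t h h' => ⟨by simpa using h, by simpa [add_mul] using h'⟩
    exact h measurableSet_Ioi
  · have h : b < sensorCusum Z s (k * T + T) ω :=
      lt_of_lt_of_le hω.2 (blockSum_le_pathCusum _ _ hT)
    refine (firstTime_le h).trans (le_of_eq ?_)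
    push_cast; ring

lemma lintegral_alarmTime_le [Fintype S] {A : Finset S} {M : ℕ} (hM : A.card = M) (b : S → ℝ)
    {T : ℕ} (hT : 0 < T) :
    ∫⁻ ω, alarmTime Z M b ω ∂P ≤ ∑ s ∈ A, T / sumLaw (μ s) T (Set.Ioi (b s)) := by
  have hm : ∀ s, Measurable (crossTime Z s (b s)) := fun s => measurable_firstTime fun t =>
    measurableSet_lt measurable_const (hZ.measurable_sensorCusum s t)
  calc ∫⁻ ω, alarmTime Z M b ω ∂P ≤ ∫⁻ ω, ∑ s ∈ A, crossTime Z s (b s) ω ∂P :=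
        lintegral_mono fun ω => alarmTime_le hM fun s hs =>
          Finset.single_le_sum (f := fun s => crossTime Z s (b s) ω) (fun _ _ => zero_le) hs
    _ = ∑ s ∈ A, ∫⁻ ω, crossTime Z s (b s) ω ∂P := lintegral_finsetSum _ fun s _ => hm s
    _ ≤ _ := Finset.sum_le_sum fun s _ => hZ.lintegral_crossTime_le s (b s) hT

/-- A trial succeeds if all sensors of `A` have a large sum over the same block. They then exceed
their thresholds at one common time, and independence of the sensors gives the product. -/
lemma lintegral_voteTime_le [Fintype S] {A : Finset S} {M : ℕ} (hM : A.card = M) (b : S → ℝ)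
    {T : ℕ} (hT : 0 < T) :
    ∫⁻ ω, voteTime Z M b ω ∂P ≤ T / ∏ s ∈ A, sumLaw (μ s) T (Set.Ioi (b s)) := by
  have hmeas : ∀ k s, MeasurableSet[sig Z {p | (0 + k * T < p.1 ∧ p.1 ≤ 0 + (k + 1) * T) ∧
      p.2 = s}] {ω | b s < sensorSum Z s (k * T) T ω} := by
    intro k s
    have h : Measurable[sig Z {p | (0 + k * T < p.1 ∧ p.1 ≤ 0 + (k + 1) * T) ∧ p.2 = s}]
        (sensorSum Z s (k * T) T) :=
      measurable_sensorSum_sig fun t h h' =>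
        ⟨⟨by simpa using h, by simpa [add_mul] using h'⟩, rfl⟩
    exact h measurableSet_Ioi
  have h := hZ.setLIntegral_le_of_trials (t₀ := 0) hT (A := Set.univ) MeasurableSet.univ
    (E := fun k => ⋂ s ∈ A, {ω | b s < sensorSum Z s (k * T) T ω})
    (q := ∏ s ∈ A, sumLaw (μ s) T (Set.Ioi (b s)))
    (D := voteTime Z M b) (fun k => ?_) (fun k => ?_) fun k ω hω => ?_
  · simpa using h
  · exact Finset.measurableSet_biInter A fun s _ =>
      measurableSet_sig_mono (fun p hp => hp.1) (hmeas k s)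
  · rw [hZ.measure_biInter_sensors A fun s _ =>
      measurableSet_sig_mono (fun p hp => hp.2) (hmeas k s)]
    exact (Finset.prod_congr rfl fun s _ => hZ.measure_sensorSum_gt s _ T (b s)).ge
  · have h : ∀ s ∈ A, b s < sensorCusum Z s (k * T + T) ω := by
      intro s hs
      have : ω ∈ ⋂ s ∈ A, {ω | b s < sensorSum Z s (k * T) T ω} := hω.2
      simp only [Set.mem_iInter] at this
      exact lt_of_lt_of_le (this s hs) (blockSum_le_pathCusum _ _ hT)
    have h2 : voteTime Z M b ω ≤ (k * T + T : ℕ) := firstTime_le (le_ncard_iff.2 ⟨A, hM, h⟩)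
    refine h2.trans (le_of_eq ?_)
    push_cast; ring

/-- Before the change, the voting rule with all sensors has a long average run length. -/
lemma lintegral_voteTime_ge [Fintype S]
    (hμ : ∀ s, ∫⁻ x, ENNReal.ofReal (Real.exp x) ∂(μ s) ≤ 1) {N : ℕ} (hN : N = Fintype.card S)
    (hN0 : 0 < N) {b : S → ℝ} (hb : ∀ s, 0 ≤ b s) :
    ENNReal.ofReal (1 / 4 * Real.exp (∑ s, b s)) ≤ ∫⁻ ω, voteTime Z N b ω ∂P := by
  have h := lintegral_firstTime_ge (P := P)
    (p := fun ω t => N ≤ {s | b s < sensorCusum Z s t ω}.ncard) (fun t => measurableSet_le_ncard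
      fun s => measurableSet_lt measurable_const (hZ.measurable_sensorCusum s t))
    (Real.exp_pos (-∑ s, b s)) fun m => ?_
  · refine le_trans (le_of_eq ?_) h
    congr 1
    rw [Real.exp_neg]
    field_simp
  · have h1 : {ω | ∃ t ≤ m, N ≤ {s | b s < sensorCusum Z s t ω}.ncard} ⊆
        ⋃ t ∈ Finset.Icc 1 m, ⋂ s ∈ Finset.univ, {ω | b s < sensorCusum Z s t ω} := by
      rintro ω ⟨t, htm, ht⟩
      obtain ⟨A, hA, hAs⟩ := le_ncard_iff.1 ht
      have hAu : A = Finset.univ := Finset.eq_univ_of_card A (hA.trans hN)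
      have ht0 : t ≠ 0 := by
        rintro rfl
        obtain ⟨s, hs⟩ : A.Nonempty := Finset.card_pos.1 (hA ▸ hN0)
        exact absurd (hAs s hs) (not_lt.2 (hb s))
      simp only [Set.mem_iUnion, Set.mem_iInter]
      exact ⟨t, Finset.mem_Icc.2 ⟨by omega, htm⟩, fun s _ => hAs s (hAu ▸ Finset.mem_univ s)⟩
    have h2 : ∀ t, P (⋂ s ∈ Finset.univ, {ω | b s < sensorCusum Z s t ω}) ≤
        ENNReal.ofReal (Real.exp (-∑ s, b s)) := by
      intro t
      rw [hZ.measure_biInter_sensors, ← Finset.sum_neg_distrib, Real.exp_sum,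
        ENNReal.ofReal_prod_of_nonneg fun _ _ => (Real.exp_pos _).le]
      · refine Finset.prod_le_prod' fun s _ => ?_
        refine (measure_mono fun ω hω => ?_).trans (hZ.measure_sensorCusum_gt_le (hμ s) t (b s))
        exact lt_max_of_lt_right (Set.mem_ofPred_eq ▸ hω)
      · intro s _
        have h : Measurable[sig Z {p | p.2 = s}] (sensorCusum Z s t) :=
          measurable_sensorCusum_sig fun i _ _ => rfl
        exact h measurableSet_Ioi
    refine (measure_mono h1).trans ((measure_biUnion_finset_le _ _).trans
      ((Finset.sum_le_sum fun t _ => h2 t).trans (le_of_eq ?_)))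
    rw [Finset.sum_const, Nat.card_Icc, ENNReal.ofReal_mul (by positivity)]
    simp

/-- Before the change, an alarm rule that needs a sensor from `B` has a long average run
length. -/
lemma lintegral_alarmTime_ge [Fintype S] {M : ℕ} {B : Finset S} (hB0 : B.Nonempty)
    (hB : ∀ A : Finset S, A.card = M → ∃ s ∈ A, s ∈ B)
    (hμ : ∀ s ∈ B, ∫⁻ x, ENNReal.ofReal (Real.exp x) ∂(μ s) ≤ 1)
    {b : S → ℝ} {β : ℝ} (hβ : 0 ≤ β) (hb : ∀ s ∈ B, b s = β) :
    ENNReal.ofReal (1 / (4 * B.card) * Real.exp β) ≤ ∫⁻ ω, alarmTime Z M b ω ∂P := by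
  have hcard : (0 : ℝ) < B.card := by exact_mod_cast hB0.card_pos
  have h := lintegral_firstTime_ge (P := P)
    (p := fun ω t => M ≤ {s | ∃ r ≤ t, b s < sensorCusum Z s r ω}.ncard)
    (fun t => measurableSet_le_ncard fun s => hZ.sig_le _ _ (measurableSet_exists_gt s (b s) t))
    (q := B.card * Real.exp (-β)) (mul_pos hcard (Real.exp_pos _)) fun m => ?_
  · refine le_trans (le_of_eq ?_) h
    congr 1
    rw [Real.exp_neg]
    field_simp
  · have h1 : {ω | ∃ t ≤ m, M ≤ {s | ∃ r ≤ t, b s < sensorCusum Z s r ω}.ncard} ⊆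
        ⋃ t ∈ Finset.Icc 1 m, ⋃ s ∈ B, {ω | β < max 0 (sensorCusum Z s t ω)} := by
      rintro ω ⟨t, htm, ht⟩
      obtain ⟨A, hA, hAs⟩ := le_ncard_iff.1 ht
      obtain ⟨s, hsA, hsB⟩ := hB A hA
      obtain ⟨r, hrt, hr⟩ := hAs s hsA
      rw [hb s hsB] at hr
      have hr0 : r ≠ 0 := by
        rintro rfl
        exact absurd hr (not_lt.2 hβ)
      simp only [Set.mem_iUnion]
      exact ⟨r, Finset.mem_Icc.2 ⟨by omega, hrt.trans htm⟩, s, hsB, lt_max_of_lt_right hr⟩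
    have h2 : ∀ t, P (⋃ s ∈ B, {ω | β < max 0 (sensorCusum Z s t ω)}) ≤
        ENNReal.ofReal (B.card * Real.exp (-β)) := by
      intro t
      refine (measure_biUnion_finset_le _ _).trans ((Finset.sum_le_sum fun s hs =>
        hZ.measure_sensorCusum_gt_le (hμ s hs) t β).trans (le_of_eq ?_))
      rw [Finset.sum_const, ENNReal.ofReal_mul hcard.le]
      simp
    refine (measure_mono h1).trans ((measure_biUnion_finset_le _ _).trans
      ((Finset.sum_le_sum fun t _ => h2 t).trans (le_of_eq ?_)))
    rw [Finset.sum_const, Nat.card_Icc, ENNReal.ofReal_mul (Nat.cast_nonneg m)]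
    simp

/-- Raising all thresholds delays the alarm rule by at most the sum of the individual delays. -/
lemma lintegral_alarmTime_le_add [Fintype S] {K m : S → ℝ} (hK : ∀ s, 0 ≤ K s)
    (hm : ∀ s, 0 < m s) (hint : ∀ s, Integrable id (μ s))
    (hKm : ∀ s, ∫ x, min x (K s) ∂(μ s) = m s) {b b' : S → ℝ} (hb : ∀ s, b s ≤ b' s) (M : ℕ) :
    ∫⁻ ω, alarmTime Z M b' ω ∂P ≤ ∫⁻ ω, alarmTime Z M b ω ∂P +
      ENNReal.ofReal (∑ s, (b' s - b s + K s) / m s) := by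
  refine (lintegral_mono fun ω => alarmTime_le_add M b b' ω).trans ?_
  rw [lintegral_add_left (hZ.measurable_alarmTime M b), lintegral_finsetSum,
    ENNReal.ofReal_sum_of_nonneg]
  · gcongr with s
    exact hZ.lintegral_tsum_betweenSet_le (hK s) (hm s) (hint s) (hKm s) (hb s)
  · intro s _
    have := hb s
    have := hK s
    exact div_nonneg (by linarith) (hm s).le
  · exact fun s _ => Measurable.tsum fun i => measurable_const.indicator
      (hZ.sig_le _ _ (measurableSet_betweenSet s (b s) (b' s) i))

open Classical in
/-- A lower bound for the gap between two alarm rules. -/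
lemma lintegral_alarmTime_gap [Fintype S] {A : Finset S} {M M' : ℕ} (hM : A.card = M)
    (hMM' : M < M') (b : S → ℝ) {t₁ t₂ : ℕ} (ht₁ : 0 < t₁) :
    ∫⁻ ω, alarmTime Z M b ω ∂P + ((t₂ - t₁ : ℕ) : ℝ≥0∞) *
      ∏ s, (if s ∈ A then sumLaw (μ s) t₁ (Set.Ioi (b s)) else
        P {ω | ∃ r ≤ t₂, b s < sensorCusum Z s r ω}ᶜ) ≤ ∫⁻ ω, alarmTime Z M' b ω ∂P := by
  -- On the intersection of the `E s` the sensors of `A` have raised `M` alarms by `t₁` and no other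
  -- sensor has alarmed by `t₂`. Since `M'` alarms need a sensor outside `A`, the rules then differ
  -- by at least `t₂ - t₁`; elsewhere monotonicity suffices.
  set E : S → Set Ω := fun s => if s ∈ A then {ω | b s < sensorSum Z s 0 t₁ ω} else
    {ω | ∃ r ≤ t₂, b s < sensorCusum Z s r ω}ᶜ with hE
  have hEm : ∀ s ∈ Finset.univ, MeasurableSet[sig Z {p | p.2 = s}] (E s) := by
    intro s _
    by_cases hs : s ∈ A
    · have h : Measurable[sig Z {p | p.2 = s}] (sensorSum Z s 0 t₁) :=
        measurable_sensorSum_sig fun t _ _ => rfl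
      simp only [hE, hs, if_true]
      exact h measurableSet_Ioi
    · simp only [hE, hs, if_false]
      exact (measurableSet_sig_mono (fun p hp => hp.2)
        (measurableSet_exists_gt s (b s) t₂)).compl
  have hEm' : MeasurableSet (⋂ s ∈ Finset.univ, E s) :=
    Finset.measurableSet_biInter _ fun s hs => hZ.sig_le _ _ (hEm s hs)
  have hP : P (⋂ s ∈ Finset.univ, E s) =
      ∏ s, (if s ∈ A then sumLaw (μ s) t₁ (Set.Ioi (b s)) else
        P {ω | ∃ r ≤ t₂, b s < sensorCusum Z s r ω}ᶜ) := by
    rw [hZ.measure_biInter_sensors Finset.univ hEm]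
    refine Finset.prod_congr rfl fun s _ => ?_
    by_cases hs : s ∈ A
    · simp only [hE, hs, if_true]
      exact hZ.measure_sensorSum_gt s 0 t₁ (b s)
    · simp only [hE, hs, if_false]
  rw [← hP, ← lintegral_indicator_const hEm',
    ← lintegral_add_left (hZ.measurable_alarmTime M b)]
  refine lintegral_mono fun ω => ?_
  by_cases hω : ω ∈ ⋂ s ∈ Finset.univ, E s
  swap
  · rw [Set.indicator_of_notMem hω, add_zero]
    exact alarmTime_mono hMM'.le (fun _ => le_rfl) ω
  rw [Set.indicator_of_mem hω]
  simp only [Set.mem_iInter] at hω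
  have h1 : alarmTime Z M b ω ≤ t₁ := by
    refine firstTime_le (le_ncard_iff.2 ⟨A, hM, fun s hs => ⟨t₁, le_rfl, ?_⟩⟩)
    have h := hω s (Finset.mem_univ s)
    simp only [hE, hs, if_true] at h
    have h2 := blockSum_le_pathCusum (fun t => Z (t, s) ω) 0 ht₁
    rw [zero_add] at h2
    exact lt_of_lt_of_le h h2
  rcases le_total t₂ t₁ with h12 | h12
  · rw [Nat.sub_eq_zero_of_le h12, Nat.cast_zero, add_zero]
    exact alarmTime_mono hMM'.le (fun _ => le_rfl) ω
  have h2 : (t₂ : ℝ≥0∞) ≤ alarmTime Z M' b ω := by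
    refine le_firstTime fun t ht => ?_
    by_contra hlt
    have hlt' : t < t₂ := by exact_mod_cast not_le.1 hlt
    obtain ⟨A', hA', hAs⟩ := le_ncard_iff.1 ht
    obtain ⟨s, hs, hsA⟩ := Finset.exists_mem_notMem_of_card_lt_card (by omega : A.card < A'.card)
    obtain ⟨r, hr, hrb⟩ := hAs s hs
    have h := hω s (Finset.mem_univ s)
    simp only [hE, hsA, if_false] at h
    exact h ⟨r, by omega, hrb⟩
  calc _ ≤ (t₁ : ℝ≥0∞) + (t₂ - t₁ : ℕ) := by gcongr
    _ = t₂ := by exact_mod_cast (by omega)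
    _ ≤ _ := h2

end IsSample

end Rules

/-! ### Elementary asymptotics -/

lemma eventually_le_sqrt (C : ℝ) {θ : ℝ} (hθ : 0 < θ) : ∀ᶠ h : ℝ in atTop, C ≤ θ * √h :=
  (Real.tendsto_sqrt_atTop.const_mul_atTop hθ).eventually_ge_atTop C

lemma eventually_sqrt_add_le (C : ℝ) {θ : ℝ} (hθ : 0 < θ) :
    ∀ᶠ h : ℝ in atTop, √h + C ≤ θ * h := by
  filter_upwards [eventually_le_sqrt (1 + |C|) hθ, eventually_ge_atTop 1] with h h1 h2
  have h3 : 1 ≤ √h := Real.one_le_sqrt.2 h2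
  have h4 : √h * √h = h := Real.mul_self_sqrt (by linarith)
  have h5 : (1 + |C|) * √h ≤ θ * √h * √h := by gcongr
  have h6 : |C| ≤ |C| * √h := le_mul_of_one_le_right (abs_nonneg C) h3
  nlinarith [le_abs_self C]

lemma eventually_mul_le_exp_sqrt (C : ℝ) {δ : ℝ} (hδ : 0 < δ) :
    ∀ᶠ h : ℝ in atTop, C * (h + 1) ≤ Real.exp (δ * √h) := by
  have h1 : (fun x : ℝ => |C| * x ^ 2 + |C| * x ^ 0) =o[atTop] fun x => Real.exp (δ * x) :=
    ((isLittleO_pow_exp_pos_mul_atTop 2 hδ).const_mul_left _).add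
      ((isLittleO_pow_exp_pos_mul_atTop 0 hδ).const_mul_left _)
  have h2 := Real.tendsto_sqrt_atTop.eventually (h1.bound one_pos)
  filter_upwards [h2, eventually_ge_atTop 0] with h h3 h4
  rw [Real.sq_sqrt h4, pow_zero, one_mul, Real.norm_eq_abs, Real.norm_eq_abs, Real.abs_exp] at h3
  have h5 := le_abs_self (|C| * h + |C| * 1)
  have h6 : C * (h + 1) ≤ |C| * (h + 1) := by gcongr; exact le_abs_self C
  linarith

lemma tendsto_sub_mul_sqrt (η : ℝ) : Tendsto (fun h : ℝ => h - η * √h) atTop atTop := by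
  refine tendsto_atTop.2 fun b => ?_
  filter_upwards [eventually_le_sqrt (1 + |η|) one_pos, eventually_ge_atTop (max 1 (b ^ 2))]
    with h h1 h2
  have h0 : 0 ≤ h := by linarith [le_max_left 1 (b ^ 2)]
  have h4 : √h * √h = h := Real.mul_self_sqrt h0
  have h5 : b ≤ √h := Real.le_sqrt_of_sq_le ((le_max_right _ _).trans h2)
  have h6 : η * √h ≤ |η| * √h := by gcongr; exact le_abs_self η
  have h7 : (1 + |η|) * √h ≤ √h * √h := by gcongr; linarith
  nlinarith

lemma eventually_sub_mul_sqrt_ge (η : ℝ) : ∀ᶠ h : ℝ in atTop, h / 4 ≤ h - η * √h := by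
  filter_upwards [eventually_le_sqrt (4 / 3 * |η|) one_pos, eventually_ge_atTop 0] with h h1 h2
  have h4 : √h * √h = h := Real.mul_self_sqrt h2
  have h6 : η * √h ≤ |η| * √h := by gcongr; exact le_abs_self η
  have h7 : (4 / 3 * |η|) * √h ≤ √h * √h := by gcongr; linarith
  nlinarith

/-! ### Sums of log-likelihood ratios -/

section SingleSensor

variable {F G : Measure ℝ} [IsProbabilityMeasure F] [IsProbabilityMeasure G] {I v : ℝ}

/-- Before the change, the sum of about `h` log-likelihood ratios exceeds `I h` with probability
`exp (-I h + O(√h))`. -/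
lemma eventually_exp_le_sumLaw (hFG : ∀ φ : ℝ → ℝ≥0∞, Measurable φ →
      ∫⁻ x, φ x ∂G = ∫⁻ x, φ x * ENNReal.ofReal (Real.exp x) ∂F)
    (hG : HasMoments G I v) (hv : v ≠ 0) (hI : 0 < I) {δ : ℝ} (hδ : 0 < δ) :
    ∀ᶠ h : ℝ in atTop, ENNReal.ofReal (Real.exp (-(I * h + δ * √h))) ≤
      sumLaw F ⌈h⌉₊ (Set.Ioi (I * h)) := by
  -- At `T = ⌈h⌉₊` this window lies above `I h` by at most `δ / 2 * √h`, which is the cost of the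
  -- change of measure. The remaining `δ / 2 * √h` absorbs the constant `c`.
  obtain ⟨c, hc, hclt⟩ := exists_le_sumLaw_Ioo hG hv (a := 0) (b := δ / 4) (by positivity)
  filter_upwards [(tendsto_nat_ceil_atTop (α := ℝ)).eventually hclt, eventually_ge_atTop 0,
    eventually_le_sqrt (I + δ / 4) (θ := δ / 4) (by positivity),
    eventually_le_sqrt (-Real.log c) (θ := δ / 2) (by positivity)] with h h1 h2 h3 h4
  set T := ⌈h⌉₊
  have hT1 : h ≤ T := Nat.le_ceil h
  have hT2 : (T : ℝ) < h + 1 := Nat.ceil_lt_add_one h2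
  have hsT : √(T : ℝ) ≤ √h + 1 := by
    refine Real.sqrt_le_iff.2 ⟨by positivity, ?_⟩
    nlinarith [Real.sq_sqrt h2, Real.sqrt_nonneg h]
  have hsub : Set.Ioo (I * T + 0 * √(T : ℝ)) (I * T + δ / 4 * √(T : ℝ)) ⊆
      Set.Ioo (I * h) (I * h + δ / 2 * √h) := by
    refine Set.Ioo_subset_Ioo (by nlinarith) ?_
    have : I * T ≤ I * h + I := by nlinarith
    have : δ / 4 * √(T : ℝ) ≤ δ / 4 * (√h + 1) := by gcongr
    nlinarith
  refine le_trans ?_ (sumLaw_Ioi_ge_of_tilt hFG T (I * h) (I * h + δ / 2 * √h))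
  calc ENNReal.ofReal (Real.exp (-(I * h + δ * √h)))
      ≤ ENNReal.ofReal (Real.exp (-(I * h + δ / 2 * √h)) * c) := by
        refine ENNReal.ofReal_le_ofReal ?_
        rw [← Real.exp_log hc, ← Real.exp_add]
        exact Real.exp_le_exp.2 (by linarith)
    _ ≤ _ := by
        rw [ENNReal.ofReal_mul (Real.exp_pos _).le]
        gcongr
        exact h1.trans (measure_mono hsub)

/-- After the change, the sum of `(1 + ε) h` log-likelihood ratios exceeds `I h` with probability
close to one. -/
lemma eventually_le_sumLaw (hG : HasMoments G I v) (hI : 0 < I) {ε η : ℝ} (hε : 0 < ε)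
    (hη : 0 < η) :
    ∀ᶠ h : ℝ in atTop, ENNReal.ofReal (1 - η) ≤ sumLaw G ⌈(1 + ε) * h⌉₊ (Set.Ioi (I * h)) := by
  -- With this `κ`, any `T ≥ (1 + ε) h` satisfies `T - h ≥ κ T`, so the threshold is linearly below
  -- the mean and Chebyshev gives a failure probability of order `1 / T`.
  set κ : ℝ := ε / (1 + ε) with hκ
  have hκ0 : 0 < κ := by positivity
  have hlim : Tendsto (fun h : ℝ => (1 + ε) * h) atTop atTop :=
    tendsto_id.const_mul_atTop (by positivity)
  filter_upwards [eventually_gt_atTop 0, hlim.eventually_ge_atTop (v / (I * κ) ^ 2 / η)]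
    with h h1 h2
  set T := ⌈(1 + ε) * h⌉₊
  have hT : (1 + ε) * h ≤ T := Nat.le_ceil _
  have hT0 : (0 : ℝ) < T := lt_of_lt_of_le (by positivity) hT
  have hb : I * κ * T ≤ I * T - I * h := by
    have : h ≤ T * (1 - κ) := by
      have h3 : 1 - κ = 1 / (1 + ε) := by rw [hκ]; field_simp; ring
      rw [h3, mul_one_div, le_div_iff₀ (by positivity)]
      linarith
    nlinarith
  have hb0 : 0 < I * κ * T := by positivity
  have h3 : sumLaw G T (Set.Iic (I * h)) ≤ ENNReal.ofReal η := by
    refine (sumLaw_Iic_le hG T (by linarith)).trans (ENNReal.ofReal_le_ofReal ?_)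
    have hv := hG.nonneg
    calc T * v / (I * T - I * h) ^ 2 ≤ T * v / (I * κ * T) ^ 2 := by gcongr
      _ = v / (I * κ) ^ 2 / T := by field_simp
      _ ≤ η := by
        rw [div_le_iff₀ hT0, ← div_le_iff₀' hη]
        exact h2.trans hT
  rw [← Set.compl_Iic, prob_compl_eq_one_sub measurableSet_Iic, ENNReal.ofReal_sub _ hη.le,
    ENNReal.ofReal_one]
  exact tsub_le_tsub_left h3 1

omit [IsProbabilityMeasure G] in
/-- Truncation from above at a high level preserves a positive mean. -/
lemma exists_integral_min_pos (hG : Integrable id G) (hpos : 0 < ∫ x, x ∂G) :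
    ∃ K m : ℝ, 0 ≤ K ∧ 0 < m ∧ ∫ x, min x K ∂G = m := by
  have hlim : Tendsto (fun k : ℕ => ∫ x, min x (k : ℝ) ∂G) atTop (nhds (∫ x, x ∂G)) := by
    refine tendsto_integral_of_dominated_convergence (fun x => |x|)
      (fun k => (by fun_prop : Measurable fun x : ℝ => min x (k : ℝ)).aestronglyMeasurable)
      hG.norm (fun k => Eventually.of_forall fun x => ?_) (Eventually.of_forall fun x => ?_)
    · rw [Real.norm_eq_abs, abs_le]
      constructor
      · exact le_min (neg_abs_le x) ((neg_nonpos.2 (abs_nonneg x)).trans (Nat.cast_nonneg k))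
      · exact (min_le_left _ _).trans (le_abs_self x)
    · refine tendsto_const_nhds.congr' ?_
      obtain ⟨k₀, hk₀⟩ := exists_nat_ge x
      filter_upwards [eventually_ge_atTop k₀] with k hk
      exact (min_eq_left (hk₀.trans (by exact_mod_cast hk))).symm
  obtain ⟨k, hk⟩ := (hlim.eventually_const_lt hpos).exists
  exact ⟨k, _, Nat.cast_nonneg k, hk, rfl⟩

end SingleSensor

/-! ### Asymptotics of the rules -/

namespace IsSample

variable {Ω S : Type*} {mΩ : MeasurableSpace Ω} {P : Measure Ω} [IsProbabilityMeasure P]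
  [Fintype S] {Z : ℕ × S → Ω → ℝ} {F G : S → Measure ℝ} [∀ s, IsProbabilityMeasure (F s)]
  [∀ s, IsProbabilityMeasure (G s)] {I v : S → ℝ}

section PreChange

variable (hZ : IsSample Z F P)
  (hFG : ∀ s, ∀ φ : ℝ → ℝ≥0∞, Measurable φ →
      ∫⁻ x, φ x ∂(G s) = ∫⁻ x, φ x * ENNReal.ofReal (Real.exp x) ∂(F s))
  (hG : ∀ s, HasMoments (G s) (I s) (v s)) (hv : ∀ s, v s ≠ 0) (hI : ∀ s, 0 < I s)
include hZ hFG hG hv hI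

/-- The largest drift in `A` dominates the sum of the mean crossing times. The block length and the
number of sensors are absorbed by half of the `δ √h` in the exponent. -/
lemma eventually_arl_alarmTime_le {A : Finset S} {M : ℕ} (hM : A.card = M) {D : ℝ}
    (hD : ∀ s ∈ A, I s ≤ D) {δ : ℝ} (hδ : 0 < δ) :
    ∀ᶠ h : ℝ in atTop, ∫⁻ ω, alarmTime Z M (fun s => I s * h) ω ∂P ≤
      ENNReal.ofReal (Real.exp (D * h + δ * √h)) := by
  have hev : ∀ᶠ h : ℝ in atTop, ∀ s, ENNReal.ofReal (Real.exp (-(I s * h + δ / 2 * √h))) ≤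
      sumLaw (F s) ⌈h⌉₊ (Set.Ioi (I s * h)) :=
    eventually_all.2 fun s =>
      eventually_exp_le_sumLaw (hFG s) (hG s) (hv s) (hI s) (by positivity)
  filter_upwards [hev, eventually_gt_atTop 0,
    eventually_mul_le_exp_sqrt A.card (δ := δ / 2) (by positivity)] with h h1 h2 h3
  refine (hZ.lintegral_alarmTime_le hM _ (T := ⌈h⌉₊) (Nat.ceil_pos.2 h2)).trans ?_
  have hone : ∀ s ∈ A, (⌈h⌉₊ : ℝ≥0∞) / sumLaw (F s) ⌈h⌉₊ (Set.Ioi (I s * h)) ≤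
      ENNReal.ofReal ((h + 1) * Real.exp (D * h + δ / 2 * √h)) := by
    intro s hs
    calc (⌈h⌉₊ : ℝ≥0∞) / sumLaw (F s) ⌈h⌉₊ (Set.Ioi (I s * h))
        ≤ ENNReal.ofReal (h + 1) / ENNReal.ofReal (Real.exp (-(I s * h + δ / 2 * √h))) := by
          refine ENNReal.div_le_div ?_ (h1 s)
          rw [← ENNReal.ofReal_natCast]
          exact ENNReal.ofReal_le_ofReal (Nat.ceil_lt_add_one h2.le).le
      _ = ENNReal.ofReal ((h + 1) * Real.exp (I s * h + δ / 2 * √h)) := by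
          rw [← ENNReal.ofReal_div_of_pos (Real.exp_pos _), Real.exp_neg, div_inv_eq_mul]
      _ ≤ _ := by
          refine ENNReal.ofReal_le_ofReal ?_
          have := hD s hs
          gcongr
  refine (Finset.sum_le_sum hone).trans ?_
  rw [Finset.sum_const, nsmul_eq_mul, ← ENNReal.ofReal_natCast,
    ← ENNReal.ofReal_mul (by positivity)]
  refine ENNReal.ofReal_le_ofReal ?_
  calc (A.card : ℝ) * ((h + 1) * Real.exp (D * h + δ / 2 * √h))
      = (A.card * (h + 1)) * Real.exp (D * h + δ / 2 * √h) := by ring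
    _ ≤ Real.exp (δ / 2 * √h) * Real.exp (D * h + δ / 2 * √h) := by gcongr
    _ = _ := by rw [← Real.exp_add]; congr 1; ring

lemma eventually_arl_voteTime_le {A : Finset S} {M : ℕ} (hM : A.card = M) {δ : ℝ} (hδ : 0 < δ) :
    ∀ᶠ h : ℝ in atTop, ∫⁻ ω, voteTime Z M (fun s => I s * h) ω ∂P ≤
      ENNReal.ofReal (Real.exp ((∑ s ∈ A, I s) * h + δ * √h)) := by
  -- The error budget is shared by the `A.card` factors of the product and the block length.
  set δ' : ℝ := δ / (A.card + 1) with hδ'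
  have hev : ∀ᶠ h : ℝ in atTop, ∀ s, ENNReal.ofReal (Real.exp (-(I s * h + δ' * √h))) ≤
      sumLaw (F s) ⌈h⌉₊ (Set.Ioi (I s * h)) :=
    eventually_all.2 fun s =>
      eventually_exp_le_sumLaw (hFG s) (hG s) (hv s) (hI s) (by positivity)
  filter_upwards [hev, eventually_gt_atTop 0,
    eventually_mul_le_exp_sqrt 1 (δ := δ') (by positivity)] with h h1 h2 h3
  refine (hZ.lintegral_voteTime_le hM _ (T := ⌈h⌉₊) (Nat.ceil_pos.2 h2)).trans ?_
  calc (⌈h⌉₊ : ℝ≥0∞) / ∏ s ∈ A, sumLaw (F s) ⌈h⌉₊ (Set.Ioi (I s * h))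
      ≤ ENNReal.ofReal (Real.exp (δ' * √h)) /
          ∏ s ∈ A, ENNReal.ofReal (Real.exp (-(I s * h + δ' * √h))) := by
        refine ENNReal.div_le_div ?_ (Finset.prod_le_prod' fun s _ => h1 s)
        rw [← ENNReal.ofReal_natCast]
        refine ENNReal.ofReal_le_ofReal ?_
        linarith [Nat.ceil_lt_add_one h2.le]
    _ = ENNReal.ofReal (Real.exp ((∑ s ∈ A, I s) * h + δ * √h)) := by
        rw [← ENNReal.ofReal_prod_of_nonneg fun _ _ => (Real.exp_pos _).le, ← Real.exp_sum,
          Finset.sum_neg_distrib, Finset.sum_add_distrib, Finset.sum_const, ← Finset.sum_mul,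
          ← ENNReal.ofReal_div_of_pos (Real.exp_pos _), ← Real.exp_sub, nsmul_eq_mul]
        congr 2
        rw [hδ']
        field_simp
        ring

end PreChange

section PostChange

variable (hZ : IsSample Z G P) (hG : ∀ s, HasMoments (G s) (I s) (v s)) (hI : ∀ s, 0 < I s)
include hZ hG hI

lemma eventually_delay_voteTime_le {N : ℕ} (hN : Fintype.card S = N) {ε : ℝ} (hε : 0 < ε) :
    ∀ᶠ h : ℝ in atTop, ∫⁻ ω, voteTime Z N (fun s => I s * h) ω ∂P ≤
      ENNReal.ofReal ((1 + ε) * h) := by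
  -- Blocks of length `(1 + ε / 2) h`, after rounding up, are at most `(1 + 3 ε / 4) h`. A joint
  -- success probability of at least `r` then gives `(1 + ε) h`, and `η` secures it through
  -- Bernoulli's inequality.
  set r : ℝ := (1 + 3 * ε / 4) / (1 + ε) with hr
  have hr1 : r < 1 := by rw [hr, div_lt_one (by positivity)]; linarith
  have hr0 : 0 < r := by positivity
  set η : ℝ := (1 - r) / (N + 1) with hη
  have hη0 : 0 < η := div_pos (by linarith) (by positivity)
  have hη1 : η < 1 := by
    rw [hη, div_lt_one (by positivity)]
    have : (0 : ℝ) ≤ N := Nat.cast_nonneg N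
    linarith
  have hpow : r ≤ (1 - η) ^ N := by
    have h1 := one_add_mul_le_pow (a := -η) (by linarith) N
    have h2 : N * η ≤ 1 - r := by
      have : (N + 1) * η = 1 - r := by rw [hη]; field_simp
      nlinarith
    rw [← sub_eq_add_neg] at h1
    linarith
  have hev : ∀ᶠ h : ℝ in atTop, ∀ s, ENNReal.ofReal (1 - η) ≤
      sumLaw (G s) ⌈(1 + ε / 2) * h⌉₊ (Set.Ioi (I s * h)) :=
    eventually_all.2 fun s => eventually_le_sumLaw (hG s) (hI s) (by positivity) hη0
  filter_upwards [hev, eventually_ge_atTop (4 / ε)] with h h1 h2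
  have h0 : 0 < h := lt_of_lt_of_le (by positivity) h2
  refine (hZ.lintegral_voteTime_le (A := Finset.univ) hN _ (T := ⌈(1 + ε / 2) * h⌉₊)
    (Nat.ceil_pos.2 (by positivity))).trans ?_
  calc (⌈(1 + ε / 2) * h⌉₊ : ℝ≥0∞) / ∏ s, sumLaw (G s) ⌈(1 + ε / 2) * h⌉₊ (Set.Ioi (I s * h))
      ≤ ENNReal.ofReal ((1 + 3 * ε / 4) * h) / ENNReal.ofReal r := by
        refine ENNReal.div_le_div ?_ ?_
        · rw [← ENNReal.ofReal_natCast]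
          refine ENNReal.ofReal_le_ofReal ?_
          have h3 := Nat.ceil_lt_add_one (a := (1 + ε / 2) * h) (by positivity)
          have h4 : 4 ≤ ε * h := by rwa [div_le_iff₀' hε] at h2
          nlinarith
        · calc ENNReal.ofReal r ≤ ENNReal.ofReal ((1 - η) ^ N) := ENNReal.ofReal_le_ofReal hpow
            _ = ∏ _s : S, ENNReal.ofReal (1 - η) := by
              rw [Finset.prod_const, Finset.card_univ, hN, ENNReal.ofReal_pow (by linarith)]
            _ ≤ _ := Finset.prod_le_prod' fun s _ => h1 s
    _ = ENNReal.ofReal ((1 + ε) * h) := by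
        rw [← ENNReal.ofReal_div_of_pos hr0, hr]
        congr 1
        field_simp

omit [∀ s, IsProbabilityMeasure (G s)] in
-- By the maximal inequality it is unlikely that even one sensor crosses before `(1 - ε / 2) h`. The
-- slack `2 c` there equals `I s * ε / 2 * h`, the distance from the drift to the threshold.
lemma eventually_delay_alarmTime_ge {M : ℕ} (hM : 0 < M) {ε : ℝ} (hε : 0 < ε) (hε1 : ε < 1) :
    ∀ᶠ h : ℝ in atTop, ENNReal.ofReal ((1 - ε) * h) ≤
      ∫⁻ ω, alarmTime Z M (fun s => I s * h) ω ∂P := by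
  set C : ℝ := ∑ s, v s / (I s * ε / 4) ^ 2 with hC
  have hC0 : 0 ≤ C := Finset.sum_nonneg fun s _ => div_nonneg (hG s).nonneg (sq_nonneg _)
  filter_upwards [eventually_gt_atTop 0, eventually_ge_atTop (C / (ε / 2))] with h h1 h2
  set t : ℕ := ⌊(1 - ε / 2) * h⌋₊ with ht
  have ht1 : (t : ℝ) ≤ (1 - ε / 2) * h := Nat.floor_le (by nlinarith)
  have ht2 : (1 - ε / 2) * h < t + 1 := Nat.lt_floor_add_one _
  set E : Set Ω := {ω | ∃ s, ∃ r ≤ t, I s * h < sensorCusum Z s r ω} with hE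
  have hEU : E = ⋃ s ∈ Finset.univ, {ω | ∃ r ≤ t, I s * h < sensorCusum Z s r ω} := by
    ext; simp [hE]
  have hEm : MeasurableSet E := by
    rw [hEU]
    exact Finset.measurableSet_biUnion _ fun s _ =>
      hZ.sig_le _ _ (measurableSet_exists_gt s (I s * h) t)
  have hPE : P E ≤ ENNReal.ofReal (ε / 2) := by
    calc P E ≤ ∑ s, ENNReal.ofReal (v s / (I s * ε / 4) ^ 2 / h) := by
          rw [hEU]
          refine (measure_biUnion_finset_le _ _).trans (Finset.sum_le_sum fun s _ => ?_)
          have hIs := hI s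
          have hvs := (hG s).nonneg
          refine (hZ.measure_exists_sensorCusum_gt_le (hG s) hIs.le t
            (c := I s * ε / 4 * h) (by positivity) ?_).trans (ENNReal.ofReal_le_ofReal ?_)
          · nlinarith [mul_le_mul_of_nonneg_left ht1 hIs.le]
          · have h3 : (t : ℝ) ≤ h := by nlinarith
            calc t * v s / (I s * ε / 4 * h) ^ 2 ≤ h * v s / (I s * ε / 4 * h) ^ 2 := by gcongr
              _ = _ := by field_simp
      _ = ENNReal.ofReal (C / h) := by
          rw [← ENNReal.ofReal_sum_of_nonneg fun s _ =>
            div_nonneg (div_nonneg (hG s).nonneg (sq_nonneg _)) h1.le, ← Finset.sum_div]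
      _ ≤ ENNReal.ofReal (ε / 2) := by
          refine ENNReal.ofReal_le_ofReal ?_
          rw [div_le_iff₀ h1, ← div_le_iff₀' (by positivity)]
          exact h2
  have hPEc : ENNReal.ofReal (1 - ε / 2) ≤ P Eᶜ := by
    rw [prob_compl_eq_one_sub hEm, ENNReal.ofReal_sub _ (by positivity), ENNReal.ofReal_one]
    exact tsub_le_tsub_left hPE 1
  calc ENNReal.ofReal ((1 - ε) * h) ≤ ENNReal.ofReal ((1 - ε / 2) * h * (1 - ε / 2)) :=
        ENNReal.ofReal_le_ofReal (by nlinarith [sq_nonneg ε])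
    _ ≤ ((t + 1 : ℕ) : ℝ≥0∞) * P Eᶜ := by
        rw [ENNReal.ofReal_mul (by nlinarith)]
        refine mul_le_mul' ?_ hPEc
        rw [← ENNReal.ofReal_natCast]
        refine ENNReal.ofReal_le_ofReal ?_
        push_cast
        exact ht2.le
    _ = ∫⁻ ω, Eᶜ.indicator (fun _ => ((t + 1 : ℕ) : ℝ≥0∞)) ω ∂P := by
        rw [lintegral_indicator_const hEm.compl]
    _ ≤ _ := by
        refine lintegral_mono fun ω => ?_
        refine Set.indicator_apply_le' (fun hω => le_firstTime fun r hr => ?_) fun _ => zero_le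
        obtain ⟨A, hA, hAs⟩ := le_ncard_iff.1 hr
        obtain ⟨s, hs⟩ : A.Nonempty := Finset.card_pos.1 (hA ▸ hM)
        obtain ⟨i, hi, hib⟩ := hAs s hs
        have : t < r := by
          by_contra hcon
          exact hω ⟨s, i, by omega, hib⟩
        exact_mod_cast this

/-- First-order asymptotics would leave an error `o(h)`, too coarse for shifting thresholds by a
multiple of `√h`. The truncated Wald bound has only a bounded error besides the linear term. -/
lemma exists_delay_alarmTime_le_add (M : ℕ) : ∃ C : ℝ, 0 < C ∧ ∀ h₀ h : ℝ, h₀ ≤ h →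
    ∫⁻ ω, alarmTime Z M (fun s => I s * h) ω ∂P ≤
      ∫⁻ ω, alarmTime Z M (fun s => I s * h₀) ω ∂P + ENNReal.ofReal (C * (h - h₀ + 1)) := by
  have hint : ∀ s, Integrable id (G s) := fun s => (hG s).memLp.integrable (by norm_num)
  choose K m hK hm hKm using fun s =>
    exists_integral_min_pos (hint s) (by rw [(hG s).integral_eq]; exact hI s)
  have hnn : ∀ s, 0 ≤ (I s + K s) / m s := fun s =>
    div_nonneg (add_nonneg (hI s).le (hK s)) (hm s).le
  refine ⟨1 + ∑ s, (I s + K s) / m s, by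
    have := Finset.sum_nonneg fun s (_ : s ∈ Finset.univ) => hnn s
    linarith, fun h₀ h hh => ?_⟩
  refine (hZ.lintegral_alarmTime_le_add hK hm hint hKm
    (b := fun s => I s * h₀) (b' := fun s => I s * h)
    (fun s => mul_le_mul_of_nonneg_left hh (hI s).le) M).trans ?_
  refine add_le_add_right (ENNReal.ofReal_le_ofReal ?_) _
  rw [add_mul, Finset.sum_mul]
  refine le_add_of_nonneg_of_le (by linarith) (Finset.sum_le_sum fun s _ => ?_)
  rw [div_mul_eq_mul_div, div_le_div_iff_of_pos_right (hm s)]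
  nlinarith [hI s, mul_nonneg (hK s) (sub_nonneg.2 hh)]

omit [∀ s, IsProbabilityMeasure (G s)] in
-- The maximal inequality at scale `√h`: the margin `κ √h` is a fixed number of standard deviations,
-- so one `κ` works for all `h` and all sensors.
lemma eventually_compl_ge : ∀ᶠ κ : ℝ in atTop, ∀ s, ∀ h : ℝ, 0 < h →
    ∀ t : ℕ, (t : ℝ) ≤ h - κ * √h →
    ENNReal.ofReal (1 / 2) ≤ P {ω | ∃ r ≤ t, I s * h < sensorCusum Z s r ω}ᶜ := by
  refine eventually_all.2 fun s => ?_
  filter_upwards [eventually_ge_atTop 1, eventually_ge_atTop (8 * v s / I s ^ 2)] with κ h1 h2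
  intro h hh t ht
  have hIs := hI s
  have hvs := (hG s).nonneg
  have hsq : 0 < √h := Real.sqrt_pos.2 hh
  have h3 : P {ω | ∃ r ≤ t, I s * h < sensorCusum Z s r ω} ≤ ENNReal.ofReal (1 / 2) := by
    refine (hZ.measure_exists_sensorCusum_gt_le (hG s) hIs.le t
      (c := I s * κ * √h / 2) (by positivity) ?_).trans (ENNReal.ofReal_le_ofReal ?_)
    · nlinarith
    · have h4 : (t : ℝ) ≤ h := ht.trans (by nlinarith)
      have h5 : (I s * κ * √h / 2) ^ 2 = h * (I s ^ 2 * κ ^ 2 / 4) := by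
        rw [div_pow, mul_pow, mul_pow, Real.sq_sqrt hh.le]; ring
      rw [h5, div_le_iff₀ (by positivity)]
      have h6 : 8 * v s ≤ I s ^ 2 * κ ^ 2 := by
        rw [div_le_iff₀ (by positivity)] at h2
        nlinarith [mul_le_mul_of_nonneg_left h1 (by positivity : 0 ≤ κ * I s ^ 2)]
      have h7 : t * v s ≤ h * v s := by gcongr
      nlinarith [mul_le_mul_of_nonneg_left h6 hh.le]
  rw [prob_compl_eq_one_sub (hZ.sig_le _ _ (measurableSet_exists_gt s (I s * h) t))]
  calc ENNReal.ofReal (1 / 2) = 1 - ENNReal.ofReal (1 / 2) := by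
        rw [← ENNReal.ofReal_one, ← ENNReal.ofReal_sub _ (by norm_num)]; norm_num
    _ ≤ _ := tsub_le_tsub_left h3 1

/-- After the change, waiting for more alarms costs a delay of order `√h`. -/
lemma exists_eventually_delay_gap (hv : ∀ s, v s ≠ 0) {M M' : ℕ} (hMM' : M < M')
    (hM' : M' ≤ Fintype.card S) : ∃ c : ℝ, 0 < c ∧ ∀ᶠ h : ℝ in atTop,
    ∫⁻ ω, alarmTime Z M (fun s => I s * h) ω ∂P + ENNReal.ofReal (c * √h) ≤
      ∫⁻ ω, alarmTime Z M' (fun s => I s * h) ω ∂P := by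
  classical
  obtain ⟨A, -, hA⟩ := Finset.exists_subset_card_eq
    (s := (Finset.univ : Finset S)) (n := M) (by rw [Finset.card_univ]; omega)
  obtain ⟨κ, hκ, hκ0⟩ := ((eventually_compl_ge hZ hG hI).and (eventually_ge_atTop 0)).exists
  -- To be above `I s * h` at time `t₁`, the sum must exceed its mean by `I s * (h - t₁)`, which is
  -- at most `I s * (κ + 3) * √h`. The factor `2` comes from `√h ≤ 2 * √t₁`.
  have hclt : ∀ s, ∃ c : ℝ, 0 < c ∧ ∀ᶠ T : ℕ in atTop, ENNReal.ofReal c ≤ sumLaw (G s) T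
      (Set.Ioo (I s * T + 2 * I s * (κ + 3) * √T) (I s * T + (2 * I s * (κ + 3) + 1) * √T)) :=
    fun s => exists_le_sumLaw_Ioo (hG s) (hv s) (by linarith)
  choose c₀ hc₀ hclt using hclt
  set c : ℝ := ∏ s, (if s ∈ A then c₀ s else 1 / 2) with hc
  have hc0 : 0 < c := Finset.prod_pos fun s _ => by split_ifs <;> [exact hc₀ s; norm_num]
  refine ⟨c, hc0, ?_⟩
  have hlim1 : Tendsto (fun h : ℝ => ⌊h - (κ + 2) * √h⌋₊) atTop atTop :=
    tendsto_nat_floor_atTop.comp (tendsto_sub_mul_sqrt (κ + 2))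
  filter_upwards [hlim1.eventually (eventually_all.2 hclt), hlim1.eventually_gt_atTop 0,
    eventually_sub_mul_sqrt_ge (κ + 3), eventually_ge_atTop 1,
    (tendsto_sub_mul_sqrt κ).eventually_ge_atTop 0,
    (tendsto_sub_mul_sqrt (κ + 2)).eventually_ge_atTop 0] with h h1 h2 h3 h4 h5 h6
  -- These times are `2 √h` apart before rounding, so at least `√h` apart after it.
  set t₁ := ⌊h - (κ + 2) * √h⌋₊ with ht₁
  set t₂ := ⌊h - κ * √h⌋₊ with ht₂
  have hsq : 1 ≤ √h := Real.one_le_sqrt.2 h4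
  have hsq2 : √h * √h = h := Real.mul_self_sqrt (by linarith)
  have ht₁l : (t₁ : ℝ) ≤ h - (κ + 2) * √h := Nat.floor_le h6
  have ht₁u : h - (κ + 2) * √h < t₁ + 1 := Nat.lt_floor_add_one _
  have ht₂l : (t₂ : ℝ) ≤ h - κ * √h := Nat.floor_le h5
  have ht₂u : h - κ * √h < t₂ + 1 := Nat.lt_floor_add_one _
  have hle : t₁ ≤ t₂ := Nat.floor_le_floor (by nlinarith)
  have hgap := hZ.lintegral_alarmTime_gap hA hMM' (fun s => I s * h) (t₁ := t₁) (t₂ := t₂) h2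
  refine le_trans (add_le_add_right ?_ _) hgap
  rw [mul_comm c, ENNReal.ofReal_mul (Real.sqrt_nonneg h)]
  refine mul_le_mul' ?_ ?_
  · rw [← ENNReal.ofReal_natCast]
    refine ENNReal.ofReal_le_ofReal ?_
    rw [Nat.cast_sub hle]
    nlinarith
  · rw [hc, ENNReal.ofReal_prod_of_nonneg fun s _ => by
      split_ifs <;> [exact (hc₀ s).le; norm_num]]
    refine Finset.prod_le_prod' fun s _ => ?_
    split_ifs with hs
    · refine (h1 s).trans (measure_mono fun x hx => ?_)
      have hIs := hI s
      have hx1 := hx.1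
      have hsqt : √h ≤ 2 * √(t₁ : ℝ) := by
        have h7 : h / 4 ≤ t₁ := by nlinarith
        have h8 : √(h / 4) ≤ √(t₁ : ℝ) := Real.sqrt_le_sqrt h7
        have h9 : √(h / 4) = √h / 2 := by
          rw [Real.sqrt_div (by linarith), show (4 : ℝ) = 2 ^ 2 by norm_num,
            Real.sqrt_sq (by norm_num)]
        linarith
      have h10 : h - t₁ ≤ 2 * (κ + 3) * √(t₁ : ℝ) := by
        have : (κ + 3) * √h ≤ (κ + 3) * (2 * √(t₁ : ℝ)) := by gcongr
        nlinarith
      have h11 := mul_le_mul_of_nonneg_left h10 hIs.le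
      change I s * h < x
      nlinarith
    · exact hκ s h (by linarith) t₂ ht₂l

end PostChange

end IsSample

/-! ### Comparison of two families of rules -/

/-- If the average run length of the first family is at least of order `exp (D h)`, while that of
the second one is smaller at a threshold at which its delay is larger, then the first family is
better at every large false alarm level. -/
lemma eventually_exists_thresholds {arl₁ arl₂ delay₁ delay₂ : ℝ → ℝ≥0∞} {D c : ℝ} (hD : 0 < D)
    (hc : 0 < c) (h₀ : ℝ → ℝ)
    (h1 : ∀ᶠ h : ℝ in atTop, ENNReal.ofReal (c * Real.exp (D * h)) ≤ arl₁ h)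
    (h2 : ∀ C : ℝ, ∀ᶠ h : ℝ in atTop, arl₂ (h₀ h) ≤ ENNReal.ofReal (Real.exp (D * h - C)))
    (h3 : ∀ᶠ h : ℝ in atTop, delay₁ h < delay₂ (h₀ h)) :
    ∀ᶠ γ : ℝ in atTop, ∃ h h' : ℝ, ENNReal.ofReal γ < arl₁ h ∧ arl₂ h' < ENNReal.ofReal γ ∧
      delay₁ h < delay₂ h' := by
  -- At `h = (log γ + C) / D` the first lower bound equals `γ * exp 1`, while the second family,
  -- used with `C + 1`, is at most `γ * exp (-1)`.
  set C : ℝ := 1 - Real.log c with hC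
  have hlim : Tendsto (fun γ : ℝ => (Real.log γ + C) / D) atTop atTop :=
    (tendsto_atTop_add_const_right _ C Real.tendsto_log_atTop).atTop_div_const hD
  filter_upwards [hlim.eventually h1, hlim.eventually (h2 (C + 1)), hlim.eventually h3,
    eventually_gt_atTop 0] with γ g1 g2 g3 hγ
  have hDh : D * ((Real.log γ + C) / D) = Real.log γ + C := by field_simp
  refine ⟨_, _, lt_of_lt_of_le ?_ g1, lt_of_le_of_lt g2 ?_, g3⟩
  · have hval : c * Real.exp (D * ((Real.log γ + C) / D)) = γ * Real.exp 1 := by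
      rw [hDh, hC, Real.exp_add, Real.exp_sub, Real.exp_log hγ, Real.exp_log hc]
      field_simp
    rw [hval, ENNReal.ofReal_lt_ofReal_iff (by positivity)]
    exact lt_mul_of_one_lt_right hγ (Real.one_lt_exp_iff.2 one_pos)
  · rw [ENNReal.ofReal_lt_ofReal_iff hγ, hDh]
    calc Real.exp (Real.log γ + C - (C + 1)) < Real.exp (Real.log γ) :=
          Real.exp_lt_exp.2 (by linarith)
      _ = γ := Real.exp_log hγ

/-- The comparison when the exponents of the average run lengths differ. -/
lemma eventually_exists_thresholds_of_lt {arl₁ arl₂ delay₁ delay₂ : ℝ → ℝ≥0∞} {D D' c : ℝ}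
    (hD' : 0 < D') (hDD' : D' < D) (hc : 0 < c)
    (h1 : ∀ᶠ h : ℝ in atTop, ENNReal.ofReal (c * Real.exp (D * h)) ≤ arl₁ h)
    (h2 : ∀ᶠ h : ℝ in atTop, arl₂ h ≤ ENNReal.ofReal (Real.exp (D' * h + 1 * √h)))
    (h3 : ∀ ε > 0, ∀ᶠ h : ℝ in atTop, delay₁ h ≤ ENNReal.ofReal ((1 + ε) * h))
    (h4 : ∀ ε > 0, ε < 1 → ∀ᶠ h : ℝ in atTop, ENNReal.ofReal ((1 - ε) * h) ≤ delay₂ h) :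
    ∀ᶠ γ : ℝ in atTop, ∃ h h' : ℝ, ENNReal.ofReal γ < arl₁ h ∧ arl₂ h' < ENNReal.ofReal γ ∧
      delay₁ h < delay₂ h' := by
  -- The competitor's threshold is raised to `(1 + κ) h`, which puts its exponent at the midpoint of
  -- `D'` and `D`, still below `D`.
  set κ : ℝ := (D - D') / (2 * D') with hκ
  have hκ0 : 0 < κ := div_pos (by linarith) (by positivity)
  have hlim : Tendsto (fun h : ℝ => (1 + κ) * h) atTop atTop :=
    tendsto_id.const_mul_atTop (by positivity)
  have hDκ : D' * (1 + κ) = (D + D') / 2 := by rw [hκ]; field_simp; ring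
  refine eventually_exists_thresholds (hD'.trans hDD') hc (fun h => (1 + κ) * h) h1 ?_ ?_
  · intro C
    filter_upwards [hlim.eventually h2, hlim.eventually (eventually_sqrt_add_le C
      (θ := (D - D') / 2 / (1 + κ)) (div_pos (by linarith) (by positivity)))] with h g1 g2
    refine g1.trans (ENNReal.ofReal_le_ofReal (Real.exp_le_exp.2 ?_))
    rw [← mul_assoc, div_mul_cancel₀ _ (by positivity)] at g2
    rw [← mul_assoc, hDκ]
    linarith
  · set ε : ℝ := κ / (2 * (2 + κ)) with hε
    have hε0 : 0 < ε := by positivity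
    have hε1 : ε < 1 := by rw [hε, div_lt_one (by positivity)]; linarith
    filter_upwards [h3 ε hε0, hlim.eventually (h4 ε hε0 hε1), eventually_gt_atTop 0]
      with h g1 g2 g3
    refine g1.trans_lt (lt_of_lt_of_le ?_ g2)
    have : ε * (2 + κ) = κ / 2 := by rw [hε]; field_simp
    rw [ENNReal.ofReal_lt_ofReal_iff (by have : 0 < 1 - ε := by linarith
                                         positivity), ← mul_assoc]
    refine mul_lt_mul_of_pos_right ?_ g3
    nlinarith

/-- The comparison when the exponents of the average run lengths agree and the delays differ in
the second-order term. -/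
lemma eventually_exists_thresholds_of_gap {arl₁ arl₂ delay₁ delay₂ : ℝ → ℝ≥0∞} {D c C a : ℝ}
    (hD : 0 < D) (hc : 0 < c) (hC : 0 < C) (ha : 0 < a)
    (h1 : ∀ᶠ h : ℝ in atTop, ENNReal.ofReal (c * Real.exp (D * h)) ≤ arl₁ h)
    (h2 : ∀ δ > 0, ∀ᶠ h : ℝ in atTop, arl₂ h ≤ ENNReal.ofReal (Real.exp (D * h + δ * √h)))
    (h3 : ∀ᶠ h : ℝ in atTop, delay₁ h ≠ ⊤)
    (h4 : ∀ h₀ h, h₀ ≤ h → delay₁ h ≤ delay₁ h₀ + ENNReal.ofReal (C * (h - h₀ + 1)))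
    (h5 : ∀ᶠ h : ℝ in atTop, delay₁ h + ENNReal.ofReal (a * √h) ≤ delay₂ h) :
    ∀ᶠ γ : ℝ in atTop, ∃ h h' : ℝ, ENNReal.ofReal γ < arl₁ h ∧ arl₂ h' < ENNReal.ofReal γ ∧
      delay₁ h < delay₂ h' := by
  -- Lowering the competitor's threshold by `η √h` gains `exp (-D η √h)`, twice the exponent that
  -- the error `δ = D η / 2` gives back. The leading delay cost is `C η √h = a / 8 * √h`, below the
  -- gap, which is still at least `a / 2 * √h` at the lowered threshold.
  set η : ℝ := a / (8 * C) with hη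
  have hη0 : 0 < η := by positivity
  have hlim := tendsto_sub_mul_sqrt η
  refine eventually_exists_thresholds hD hc (fun h => h - η * √h) h1 ?_ ?_
  · intro B
    filter_upwards [hlim.eventually (h2 (D * η / 2) (by positivity)),
      eventually_le_sqrt B (θ := D * η / 2) (by positivity)] with h g1 g2
    refine g1.trans (ENNReal.ofReal_le_ofReal (Real.exp_le_exp.2 ?_))
    have g3 : √(h - η * √h) ≤ √h := by
      refine Real.sqrt_le_sqrt ?_
      have := Real.sqrt_nonneg h
      nlinarith
    have g4 : D * η / 2 * √(h - η * √h) ≤ D * η / 2 * √h := by gcongr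
    nlinarith
  · filter_upwards [hlim.eventually h3, hlim.eventually h5, eventually_sub_mul_sqrt_ge η,
      eventually_le_sqrt (C + 1) (θ := a / 8) (by positivity), eventually_ge_atTop 0]
      with h g1 g2 g3 g4 g5
    have hsq := Real.sqrt_nonneg h
    refine (h4 (h - η * √h) h (by nlinarith)).trans_lt (lt_of_lt_of_le ?_ g2)
    refine ENNReal.add_lt_add_left g1 ?_
    have g6 : √h / 2 ≤ √(h - η * √h) := by
      have h8 : √(h / 4) = √h / 2 := by
        rw [Real.sqrt_div g5, show (4 : ℝ) = 2 ^ 2 by norm_num, Real.sqrt_sq (by norm_num)]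
      rw [← h8]
      exact Real.sqrt_le_sqrt g3
    have g7 : a * (√h / 2) ≤ a * √(h - η * √h) := by gcongr
    have g8 : C * (h - (h - η * √h) + 1) = a / 8 * √h + C := by
      rw [hη]; field_simp; ring
    rw [g8, ENNReal.ofReal_lt_ofReal_iff_of_nonneg (by positivity)]
    nlinarith

/-! ### Order statistics -/

section OrderStat

variable {ι : Type*} [Fintype ι] {M : ℕ}

lemma le_of_le_ncard (hM : 0 < M) {y : ι → ℝ} {a : ℝ} (h : M ≤ {i | y i ≤ a}.ncard) :
    ∃ i, y i ≤ a := by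
  obtain ⟨A, hA, hAs⟩ := le_ncard_iff.1 h
  obtain ⟨i, hi⟩ : A.Nonempty := Finset.card_pos.1 (hA ▸ hM)
  exact ⟨i, hAs i hi⟩

lemma abs_le_sum_abs (y : ι → ℝ) (i : ι) : |y i| ≤ ∑ j, |y j| :=
  Finset.single_le_sum (f := fun j => |y j|) (fun _ _ => abs_nonneg _) (Finset.mem_univ i)

/-- `orderStat` is a real infimum, which is zero by default on empty or unbounded sets. `0 < M`
gives the lower bound and `M ≤ Fintype.card ι` the nonemptiness. -/
lemma neg_sum_abs_mem_lowerBounds (hM : 0 < M) (y : ι → ℝ) :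
    -∑ j, |y j| ∈ lowerBounds {a : ℝ | M ≤ {i | y i ≤ a}.ncard} := by
  intro a ha
  obtain ⟨i, hi⟩ := le_of_le_ncard hM ha
  linarith [neg_abs_le (y i), abs_le_sum_abs y i]

lemma sum_abs_mem (hM : M ≤ Fintype.card ι) (y : ι → ℝ) :
    ∑ j, |y j| ∈ {a : ℝ | M ≤ {i | y i ≤ a}.ncard} := by
  obtain ⟨A, -, hA⟩ := Finset.exists_subset_card_eq (s := (Finset.univ : Finset ι)) hM
  exact le_ncard_iff.2 ⟨A, hA, fun i _ => (le_abs_self _).trans (abs_le_sum_abs y i)⟩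

lemma orderStat_le (hM : 0 < M) {y : ι → ℝ} {a : ℝ} (h : M ≤ {i | y i ≤ a}.ncard) :
    orderStat M y ≤ a :=
  csInf_le ⟨_, neg_sum_abs_mem_lowerBounds hM y⟩ h

lemma le_orderStat (hM : M ≤ Fintype.card ι) {y : ι → ℝ} {a : ℝ}
    (h : ∀ c, M ≤ {i | y i ≤ c}.ncard → a ≤ c) : a ≤ orderStat M y :=
  le_csInf ⟨_, sum_abs_mem hM y⟩ h

lemma orderStat_mono {M' : ℕ} (hM : 0 < M) (hMM' : M ≤ M') (hM' : M' ≤ Fintype.card ι)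
    (y : ι → ℝ) : orderStat M y ≤ orderStat M' y :=
  le_orderStat hM' fun _ hc => orderStat_le hM (hMM'.trans hc)

lemma abs_orderStat_le (hM : 0 < M) (hM' : M ≤ Fintype.card ι) (y : ι → ℝ) :
    |orderStat M y| ≤ ∑ j, |y j| :=
  abs_le.2 ⟨le_orderStat hM' fun _ hc => neg_sum_abs_mem_lowerBounds hM y hc,
    orderStat_le hM (sum_abs_mem hM' y)⟩

lemma measurable_orderStat (hM : 0 < M) (hM' : M ≤ Fintype.card ι) :
    Measurable fun y : ι → ℝ => orderStat M y := by
  refine measurable_of_Iio fun a => ?_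
  have : (fun y : ι → ℝ => orderStat M y) ⁻¹' Set.Iio a =
      ⋃ (q : ℚ) (_ : (q : ℝ) < a), {y | M ≤ {i | y i ≤ (q : ℝ)}.ncard} := by
    ext y
    simp only [Set.mem_preimage, Set.mem_Iio, Set.mem_iUnion, Set.mem_ofPred_eq, exists_prop]
    constructor
    · intro h
      obtain ⟨c, hc, hca⟩ := exists_lt_of_csInf_lt ⟨_, sum_abs_mem hM' y⟩ h
      obtain ⟨q, hcq, hqa⟩ := exists_rat_btwn hca
      exact ⟨q, hqa, hc.trans (Set.ncard_le_ncard (fun i (hi : y i ≤ c) => hi.trans hcq.le)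
        (Set.toFinite _))⟩
    · rintro ⟨q, hqa, hq⟩
      exact (orderStat_le hM hq).trans_lt hqa
  rw [this]
  exact MeasurableSet.iUnion fun q => MeasurableSet.iUnion fun _ => measurableSet_le_ncard
    fun i => measurableSet_le (measurable_pi_apply i) measurable_const

variable {Q : ι → Measure ℝ} [∀ i, IsProbabilityMeasure (Q i)]

lemma integrable_orderStat (hQ : ∀ i, Integrable id (Q i)) (hM : 0 < M)
    (hM' : M ≤ Fintype.card ι) :
    Integrable (fun y : ι → ℝ => orderStat M y) (Measure.pi Q) := by
  have h : ∀ i, Integrable (fun y : ι → ℝ => |y i|) (Measure.pi Q) := fun i =>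
    ((measurePreserving_eval Q i).integrable_comp_of_integrable (hQ i)).abs
  refine Integrable.mono' (integrable_finsetSum Finset.univ fun i _ => h i)
    (measurable_orderStat hM hM').aestronglyMeasurable (Eventually.of_forall fun y => ?_)
  exact abs_orderStat_le hM hM' y

open Classical in
/-- Expected order statistics of independent random variables with full support are strictly
increasing. -/
lemma integral_orderStat_lt (hQ : ∀ i, Integrable id (Q i))
    (hpos : ∀ i, 0 < Q i (Set.Iio (-1)) ∧ 0 < Q i (Set.Ioi 1)) {M' : ℕ} (hM : 0 < M)
    (hMM' : M < M') (hM' : M' ≤ Fintype.card ι) :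
    ∫ y, orderStat M y ∂(Measure.pi Q) < ∫ y, orderStat M' y ∂(Measure.pi Q) := by
  have hi := integrable_orderStat hQ hM (hMM'.le.trans hM')
  have hi' := integrable_orderStat hQ (hM.trans hMM') hM'
  rw [← sub_pos, ← integral_sub hi' hi, integral_pos_iff_support_of_nonneg
    (fun y => sub_nonneg.2 (orderStat_mono hM hMM'.le hM' y)) (hi'.sub hi)]
  obtain ⟨A, -, hA⟩ := Finset.exists_subset_card_eq (s := (Finset.univ : Finset ι))
    (hMM'.le.trans hM')
  -- On this box `M` coordinates are below `-1` and all others above `1`, which separates the two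
  -- order statistics on a set of positive measure.
  have hbox : 0 < Measure.pi Q
      (Set.pi Set.univ fun i => if i ∈ A then Set.Iio (-1) else Set.Ioi 1) := by
    rw [Measure.pi_pi, pos_iff_ne_zero, Finset.prod_ne_zero_iff]
    intro i _
    split_ifs
    · exact (hpos i).1.ne'
    · exact (hpos i).2.ne'
  refine hbox.trans_le (measure_mono fun y hy => ?_)
  have h1 : orderStat M y ≤ -1 := by
    refine orderStat_le hM (le_ncard_iff.2 ⟨A, hA, fun i hi => ?_⟩)
    have := hy i (Set.mem_univ i)
    simp only [hi, if_true] at this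
    exact le_of_lt this
  have h2 : 1 ≤ orderStat M' y := by
    refine le_orderStat hM' fun c hc => ?_
    obtain ⟨A', hA', hAs⟩ := le_ncard_iff.1 hc
    obtain ⟨i, hi, hiA⟩ := Finset.exists_mem_notMem_of_card_lt_card (by omega : A.card < A'.card)
    have := hy i (Set.mem_univ i)
    simp only [hiA, if_false] at this
    exact (le_of_lt this).trans (hAs i hi)
  rw [Function.mem_support]
  linarith

end OrderStat

/-! ### The sensor types -/

section TypeOf

variable {K : ℕ} {n : Fin (K + 1) → ℕ}

lemma sum_eq_sum_erase_add (n : Fin (K + 1) → ℕ) :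
    ∑ l, n l = ∑ l ∈ Finset.univ.erase (Fin.last K), n l + n (Fin.last K) :=
  (Finset.sum_erase_add _ _ (Finset.mem_univ _)).symm

lemma typeOf_eq_last {m : ℕ} (hm : ∑ l, n l - n (Fin.last K) < m) :
    typeOf n m = Fin.last K := by
  refine le_antisymm (Fin.le_last _) (Finset.le_inf fun l hl => ?_)
  by_contra hlt
  have hsub : Finset.Iic l ⊆ Finset.univ.erase (Fin.last K) := by
    intro j hj
    refine Finset.mem_erase.2 ⟨?_, Finset.mem_univ j⟩
    rintro rfl
    exact hlt (Finset.mem_Iic.1 hj)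
  have h1 := Finset.sum_le_sum_of_subset (f := n) hsub
  have h2 := (Finset.mem_filter.1 hl).2
  have h3 := sum_eq_sum_erase_add n
  omega

/-- The type just before the last already accommodates `m`. With a single type the hypotheses are
contradictory. -/
lemma typeOf_lt_last {m : ℕ} (hm0 : 0 < m) (hm : m ≤ ∑ l, n l - n (Fin.last K)) :
    typeOf n m < Fin.last K := by
  have h3 := sum_eq_sum_erase_add n
  obtain _ | k := K
  · have : (Finset.univ.erase (Fin.last 0)) = ∅ := by decide
    rw [this, Finset.sum_empty] at h3
    omega
  · refine lt_of_le_of_lt (Finset.inf_le (b := (Fin.last k).castSucc) ?_)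
      (Fin.castSucc_lt_last _)
    have : Finset.Iic (Fin.last k).castSucc = Finset.univ.erase (Fin.last (k + 1)) := by
      ext j
      simp only [Finset.mem_Iic, Finset.mem_erase, Finset.mem_univ, and_true]
      rw [← Fin.lt_last_iff_ne_last, Fin.le_def, Fin.lt_def, Fin.val_castSucc, Fin.val_last,
        Fin.val_last, Nat.lt_succ_iff]
    refine Finset.mem_filter.2 ⟨Finset.mem_univ _, ?_⟩
    rw [this]
    omega

lemma card_sensor (n : Fin (K + 1) → ℕ) : Fintype.card (Sensor n) = ∑ l, n l := by
  simp [Sensor]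

lemma card_filter_ne_last (n : Fin (K + 1) → ℕ) :
    (Finset.univ.filter fun s : Sensor n => s.1 ≠ Fin.last K).card =
      ∑ l, n l - n (Fin.last K) := by
  have h : (Finset.univ.filter fun s : Sensor n => s.1 ≠ Fin.last K) =
      (Finset.univ.erase (Fin.last K)).sigma fun l => (Finset.univ : Finset (Fin (n l))) := by
    ext s; simp
  have h3 := sum_eq_sum_erase_add n
  rw [h, Finset.card_sigma]
  simp only [Finset.card_univ, Fintype.card_fin]
  omega

end TypeOf

/-! ### The log-likelihood ratio -/

section LogLikelihood

variable {𝓧 : Type*} [MeasurableSpace 𝓧] {f g : Measure 𝓧} [IsProbabilityMeasure f]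
  [IsProbabilityMeasure g]

/-- The law of the log-likelihood ratio under `g` is the exponential tilt of its law under `f`.
Absolute continuity of `f` excludes a vanishing density, where `exp ∘ llr` would differ from it. -/
lemma lintegral_map_llr (hfg : f ≪ g) (hgf : g ≪ f) (φ : ℝ → ℝ≥0∞) (hφ : Measurable φ) :
    ∫⁻ x, φ x ∂(g.map (llr g f)) =
      ∫⁻ x, φ x * ENNReal.ofReal (Real.exp x) ∂(f.map (llr g f)) := by
  rw [lintegral_map hφ (measurable_llr g f), lintegral_map (by fun_prop) (measurable_llr g f),
    ← lintegral_rnDeriv_mul (f := fun x => φ (llr g f x)) hgf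
      (hφ.comp (measurable_llr g f)).aemeasurable]
  refine lintegral_congr_ae ?_
  filter_upwards [exp_llr_of_ac' g f hfg, Measure.rnDeriv_lt_top g f] with x h1 h2
  rw [h1, ENNReal.ofReal_toReal h2.ne, mul_comm]

lemma lintegral_exp_map_llr_le (hfg : f ≪ g) (hgf : g ≪ f) :
    ∫⁻ x, ENNReal.ofReal (Real.exp x) ∂(f.map (llr g f)) ≤ 1 := by
  have h := lintegral_map_llr hfg hgf (fun _ => 1) measurable_const
  have : IsProbabilityMeasure (g.map (llr g f)) :=
    Measure.isProbabilityMeasure_map (measurable_llr g f).aemeasurable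
  simp only [one_mul, lintegral_const, measure_univ] at h
  exact h.ge

lemma hasMoments_map_llr (hgf : g ≪ f)
    (hvar : Integrable (fun x => (llr g f x - (InformationTheory.klDiv g f).toReal) ^ 2) g) :
    HasMoments (g.map (llr g f)) (InformationTheory.klDiv g f).toReal
      (∫ x, (llr g f x - (InformationTheory.klDiv g f).toReal) ^ 2 ∂g) where
  memLp := by
    rw [memLp_map_measure_iff aestronglyMeasurable_id (measurable_llr g f).aemeasurable]
    have h1 : MemLp (fun x => llr g f x - (InformationTheory.klDiv g f).toReal) 2 g :=
      (memLp_two_iff_integrable_sq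
        ((measurable_llr g f).sub_const _).aestronglyMeasurable).2 hvar
    have h2 := h1.add (memLp_const (InformationTheory.klDiv g f).toReal)
    refine h2.ae_eq (Eventually.of_forall fun x => ?_)
    simp
  integral_eq := by
    rw [integral_map (measurable_llr g f).aemeasurable (f := fun x => x)
      aestronglyMeasurable_id, InformationTheory.toReal_klDiv_of_measure_eq hgf (by simp)]
  integral_sq_eq := by
    rw [integral_map (measurable_llr g f).aemeasurable (by fun_prop)]

/-- The log-likelihood ratio is not degenerate if the divergence is positive. -/
lemma integral_llr_sub_sq_ne_zero (hfg : f ≪ g) (hgf : g ≪ f) {I : ℝ} (hI : 0 < I)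
    (hvar : Integrable (fun x => (llr g f x - I) ^ 2) g) :
    ∫ x, (llr g f x - I) ^ 2 ∂g ≠ 0 := by
  intro h0
  rw [integral_eq_zero_iff_of_nonneg (fun x => sq_nonneg _) hvar] at h0
  -- A constant ratio `I > 0` would also hold almost surely under `f`, giving the likelihood ratio
  -- mean `exp I > 1` there.
  have h1 : ∀ᵐ x ∂f, llr g f x = I := by
    refine hfg.ae_le ?_
    filter_upwards [h0] with x hx
    exact sub_eq_zero.1 (pow_eq_zero_iff two_ne_zero |>.1 hx)
  have h2 := lintegral_exp_map_llr_le hfg hgf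
  rw [lintegral_map (by fun_prop) (measurable_llr g f)] at h2
  have h3 : ∫⁻ x, ENNReal.ofReal (Real.exp (llr g f x)) ∂f = ENNReal.ofReal (Real.exp I) := by
    rw [lintegral_congr_ae (g := fun _ => ENNReal.ofReal (Real.exp I))
      (h1.mono fun x hx => by simp only [hx])]
    simp
  rw [h3, ENNReal.ofReal_le_one] at h2
  linarith [Real.add_one_lt_exp hI.ne']

end LogLikelihood

/-! ### The observation model -/

section Model

variable {𝓧 : Type*} [MeasurableSpace 𝓧] {K : ℕ} (n : Fin (K + 1) → ℕ)
  (f g : Fin (K + 1) → Measure 𝓧)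

/-- The log-likelihood ratios of all observations. -/
noncomputable def llrProcess (p : ℕ × Sensor n) (x : Obs 𝓧 n) : ℝ := llr (g p.2.1) (f p.2.1) (x p)

lemma cusum_eq (s : Sensor n) (x : Obs 𝓧 n) (t : ℕ) :
    cusum n f g s x t = sensorCusum (llrProcess n f g) s t x := by
  induction t with
  | zero => rfl
  | succ t ih => rw [cusum, ih]; rfl

lemma alarm_eq (M : ℕ) (h : ℝ) :
    alarm n f g M h = alarmTime (llrProcess n f g) M fun s => kld f g s.1 * h := by
  ext x
  simp only [alarm, alarmRule, alarmTime, firstTime, thresholds, cusum_eq]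

lemma voting_eq (M : ℕ) (h : ℝ) :
    voting n f g M h = voteTime (llrProcess n f g) M fun s => kld f g s.1 * h := by
  ext x
  simp only [voting, votingRule, voteTime, firstTime, thresholds, cusum_eq]

variable [∀ l, IsProbabilityMeasure (f l)] [∀ l, IsProbabilityMeasure (g l)]

instance (ν : ℕ∞) : IsProbabilityMeasure (law n f g ν) := by
  have : ∀ p : ℕ × Sensor n, IsProbabilityMeasure
      (if (p.1 : ℕ∞) ≤ ν then f p.2.1 else g p.2.1) := fun p => by split_ifs <;> infer_instance
  unfold law
  infer_instance

lemma isSample_law_top :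
    IsSample (llrProcess n f g) (fun s => (f s.1).map (llr (g s.1) (f s.1))) (law n f g ⊤) := by
  have : ∀ p : ℕ × Sensor n, IsProbabilityMeasure
      (if (p.1 : ℕ∞) ≤ ⊤ then f p.2.1 else g p.2.1) := fun p => by split_ifs <;> infer_instance
  exact isSample_infinitePi (S := Sensor n) (Ω := fun _ => 𝓧) _
    (X := fun p => llr (g p.2.1) (f p.2.1)) (fun p => measurable_llr _ _) fun t s => by simp

/-- The coordinate at time `0` still has law `f`, but `IsSample` constrains only the laws at times
`t + 1`. -/
lemma isSample_law_zero :
    IsSample (llrProcess n f g) (fun s => (g s.1).map (llr (g s.1) (f s.1))) (law n f g 0) := by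
  have : ∀ p : ℕ × Sensor n, IsProbabilityMeasure
      (if (p.1 : ℕ∞) ≤ 0 then f p.2.1 else g p.2.1) := fun p => by split_ifs <;> infer_instance
  exact isSample_infinitePi (S := Sensor n) (Ω := fun _ => 𝓧) _
    (X := fun p => llr (g p.2.1) (f p.2.1)) (fun p => measurable_llr _ _) fun t s => by simp

variable {n f g}

omit [∀ l, IsProbabilityMeasure (f l)] [∀ l, IsProbabilityMeasure (g l)] in
lemma xi_lt {M M' : ℕ} (hpos : ∀ l, 0 < kld f g l) (hv : ∀ l, 0 < llrVar f g l) (hM : 0 < M)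
    (hMM' : M < M') (hM' : M' ≤ ∑ l, n l) : xi n f g M < xi n f g M' := by
  rw [← card_sensor] at hM'
  refine integral_orderStat_lt (fun s => ?_) (fun s => ?_) hM hMM' hM'
  · exact (memLp_id_gaussianReal 1).integrable le_rfl
  · have hne : (llrVar f g s.1 / kld f g s.1 ^ 2).toNNReal ≠ 0 := by
      rw [Ne, Real.toNNReal_eq_zero, not_le]
      exact div_pos (hv s.1) (pow_pos (hpos s.1) 2)
    constructor <;> rw [pos_iff_ne_zero] <;> intro h0
    · simpa using gaussianReal_absolutelyContinuous' 0 hne h0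
    · simpa using gaussianReal_absolutelyContinuous' 0 hne h0

omit [∀ l, IsProbabilityMeasure (f l)] [∀ l, IsProbabilityMeasure (g l)] in
-- The leading terms differ by a positive multiple of `log γ`, which outweighs both square-root
-- terms whatever the signs of the order statistics' means.
lemma eventually_expansion_lt (M M' : ℕ) {D D' : ℝ} (hD' : 0 < D') (hDD' : D' < D) :
    ∀ᶠ γ : ℝ in atTop,
      expansion n f g M (Real.log γ / D) < expansion n f g M' (Real.log γ / D') := by
  set a := xi n f g M
  set a' := xi n f g M'
  have hD : 0 < D := hD'.trans hDD'
  have hθ : 0 < 1 / D' - 1 / D := sub_pos.2 (one_div_lt_one_div_of_lt hD' hDD')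
  have key : ∀ᶠ x : ℝ in atTop, a * √(x / D) + x / D < x / D' + a' * √(x / D') := by
    filter_upwards [eventually_le_sqrt (|a| / √D + |a'| / √D' + 1) hθ, eventually_gt_atTop 0]
      with x h1 h2
    have hx : 0 < √x := Real.sqrt_pos.2 h2
    have hxx : √x * √x = x := Real.mul_self_sqrt h2.le
    rw [Real.sqrt_div h2.le, Real.sqrt_div h2.le]
    have h3 : a * (√x / √D) ≤ |a| / √D * √x := by
      rw [div_mul_eq_mul_div, ← mul_div_assoc]
      gcongr
      exact le_abs_self a
    have h4 : -(|a'| / √D' * √x) ≤ a' * (√x / √D') := by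
      rw [div_mul_eq_mul_div, ← mul_div_assoc, ← neg_div, ← neg_mul]
      gcongr
      exact neg_abs_le a'
    have h5 := mul_le_mul_of_nonneg_right h1 hx.le
    have h6 : (1 / D' - 1 / D) * √x * √x = x / D' - x / D := by
      rw [mul_assoc, hxx]; ring
    rw [h6] at h5
    linarith
  filter_upwards [Real.tendsto_log_atTop.eventually key] with γ h
  unfold expansion
  linarith

end Model

/-! ### Comparison of the rules in the observation model -/

section Optimality

variable {𝓧 : Type*} [MeasurableSpace 𝓧] {K : ℕ} {n : Fin (K + 1) → ℕ}
  {f g : Fin (K + 1) → Measure 𝓧} [∀ l, IsProbabilityMeasure (f l)]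
  [∀ l, IsProbabilityMeasure (g l)]

omit [∀ l, IsProbabilityMeasure (f l)] [∀ l, IsProbabilityMeasure (g l)] in
lemma alarm_mono (hpos : ∀ l, 0 < kld f g l) (M : ℕ) {h h' : ℝ} (hh : h ≤ h') (x : Obs 𝓧 n) :
    alarm n f g M h x ≤ alarm n f g M h' x := by
  rw [alarm_eq, alarm_eq]
  exact alarmTime_mono (Z := llrProcess n f g) (b := fun s => kld f g s.1 * h)
    (b' := fun s => kld f g s.1 * h') le_rfl (fun s => mul_le_mul_of_nonneg_left hh (hpos s.1).le) x

omit [∀ l, IsProbabilityMeasure (f l)] [∀ l, IsProbabilityMeasure (g l)] in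
lemma voting_mono (hpos : ∀ l, 0 < kld f g l) (M : ℕ) {h h' : ℝ} (hh : h ≤ h') (x : Obs 𝓧 n) :
    voting n f g M h x ≤ voting n f g M h' x := by
  rw [voting_eq, voting_eq]
  exact voteTime_mono (Z := llrProcess n f g) (b := fun s => kld f g s.1 * h)
    (b' := fun s => kld f g s.1 * h') le_rfl (fun s => mul_le_mul_of_nonneg_left hh (hpos s.1).le) x

/-- For large `γ`, some member of the family `ρ₁` with average run length above `γ` has a smaller
delay than some member of the family `ρ₂` with average run length below `γ`. -/
def EventuallyBetter (n : Fin (K + 1) → ℕ) (f g : Fin (K + 1) → Measure 𝓧)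
    (ρ₁ ρ₂ : ℝ → Obs 𝓧 n → ℝ≥0∞) : Prop :=
  ∀ᶠ γ : ℝ in atTop, ∃ h h' : ℝ, ENNReal.ofReal γ < arl n f g (ρ₁ h) ∧
    arl n f g (ρ₂ h') < ENNReal.ofReal γ ∧ delay n f g (ρ₁ h) < delay n f g (ρ₂ h')

omit [∀ l, IsProbabilityMeasure (f l)] [∀ l, IsProbabilityMeasure (g l)] in
-- By monotonicity, a competitor reaching run length `γ` uses a threshold above `a'`, and an optimum
-- with run length exactly `γ` uses one below `a`. Existence of exact solutions plays no role.
lemma EventuallyBetter.delay_lt {ρ₁ ρ₂ : ℝ → Obs 𝓧 n → ℝ≥0∞}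
    (hb : EventuallyBetter n f g ρ₁ ρ₂)
    (h₁ : ∀ h h', h ≤ h' → ∀ x, ρ₁ h x ≤ ρ₁ h' x) (h₂ : ∀ h h', h ≤ h' → ∀ x, ρ₂ h x ≤ ρ₂ h' x) :
    ∀ᶠ γ : ℝ in atTop, (∀ h h', arl n f g (ρ₁ h) = ENNReal.ofReal γ →
      arl n f g (ρ₂ h') = ENNReal.ofReal γ → delay n f g (ρ₁ h) < delay n f g (ρ₂ h')) ∧
      minDelay n f g ρ₁ γ < minDelay n f g ρ₂ γ := by
  filter_upwards [hb] with γ ⟨a, a', ha, ha', hd⟩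
  have key : ∀ h', ENNReal.ofReal γ ≤ arl n f g (ρ₂ h') →
      delay n f g (ρ₂ a') ≤ delay n f g (ρ₂ h') := by
    intro h' hh'
    refine lintegral_mono (h₂ _ _ (le_of_not_ge fun hle => ?_))
    exact absurd (hh'.trans (lintegral_mono (h₂ _ _ hle))) (not_le.2 ha')
  constructor
  · intro h h' e e'
    have hle : delay n f g (ρ₁ h) ≤ delay n f g (ρ₁ a) := by
      refine lintegral_mono (h₁ _ _ (le_of_not_ge fun hle => ?_))
      have h3 : arl n f g (ρ₁ a) ≤ arl n f g (ρ₁ h) := lintegral_mono (h₁ _ _ hle)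
      exact absurd ha (not_lt.2 (h3.trans e.le))
    exact hle.trans_lt (hd.trans_le (key h' e'.ge))
  · exact (iInf₂_le a ha).trans_lt (hd.trans_le (le_iInf₂ fun h' hh' => key h' hh'.le))

variable (hfg : ∀ l, f l ≪ g l) (hgf : ∀ l, g l ≪ f l) (hn : ∀ l, 0 < n l)
  (hpos : ∀ l, 0 < kld f g l)
  (hvar : ∀ l, Integrable (fun x => (llr (g l) (f l) x - kld f g l) ^ 2) (g l))

include hgf hvar in
lemma hasMoments_llr (l : Fin (K + 1)) :
    HasMoments ((g l).map (llr (g l) (f l))) (kld f g l) (llrVar f g l) :=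
  hasMoments_map_llr (hgf l) (hvar l)

include hfg hgf hpos hvar in
lemma llrVar_ne_zero (l : Fin (K + 1)) : llrVar f g l ≠ 0 :=
  integral_llr_sub_sq_ne_zero (hfg l) (hgf l) (hpos l) (hvar l)

include hfg hgf hn hpos hvar

omit hvar in
lemma eventually_arl_alarm_ge {Ma : ℕ} (hMa : Ma = ∑ l, n l - n (Fin.last K) + 1) :
    ∀ᶠ h : ℝ in atTop, ENNReal.ofReal (1 / (4 * (Finset.univ.filter
      fun s : Sensor n => s.1 = Fin.last K).card) * Real.exp (kld f g (Fin.last K) * h)) ≤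
      arl n f g (alarm n f g Ma h) := by
  filter_upwards [eventually_ge_atTop 0] with h hh
  rw [alarm_eq]
  refine (isSample_law_top n f g).lintegral_alarmTime_ge ?_ ?_
    (fun s _ => lintegral_exp_map_llr_le (hfg s.1) (hgf s.1)) (mul_nonneg (hpos _).le hh) ?_
  · exact ⟨⟨Fin.last K, ⟨0, hn _⟩⟩, by simp⟩
  · intro A hA
    by_contra hcon
    push Not at hcon
    have hsub : A ⊆ Finset.univ.filter fun s : Sensor n => s.1 ≠ Fin.last K := fun s hs =>
      Finset.mem_filter.2 ⟨Finset.mem_univ s, fun h => hcon s hs (by simp [h])⟩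
    have := Finset.card_le_card hsub
    rw [card_filter_ne_last] at this
    omega
  · intro s hs
    rw [(Finset.mem_filter.1 hs).2]

omit hfg hn in
lemma eventually_delay_voting_le {ε : ℝ} (hε : 0 < ε) :
    ∀ᶠ h : ℝ in atTop, delay n f g (voting n f g (∑ l, n l) h) ≤
      ENNReal.ofReal ((1 + ε) * h) := by
  have : ∀ s : Sensor n, IsProbabilityMeasure ((g s.1).map (llr (g s.1) (f s.1))) := fun s =>
    Measure.isProbabilityMeasure_map (measurable_llr _ _).aemeasurable
  have := (isSample_law_zero n f g).eventually_delay_voteTime_le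
    (fun s => hasMoments_llr hgf hvar s.1) (fun s => hpos s.1) (card_sensor n) hε
  filter_upwards [this] with h hh
  rwa [voting_eq]

omit hfg hn in
lemma eventually_delay_alarm_le {M : ℕ} (hM : M ≤ ∑ l, n l) {ε : ℝ} (hε : 0 < ε) :
    ∀ᶠ h : ℝ in atTop, delay n f g (alarm n f g M h) ≤ ENNReal.ofReal ((1 + ε) * h) := by
  filter_upwards [eventually_delay_voting_le (n := n) hgf hpos hvar hε] with h hh
  refine le_trans (lintegral_mono fun x => ?_) hh
  rw [alarm_eq, voting_eq]
  exact (alarmTime_mono hM (fun _ => le_rfl) x).trans (alarmTime_le_voteTime _ _ x)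

omit hfg hn in
lemma eventually_delay_alarm_ge {M : ℕ} (hM : 0 < M) {ε : ℝ} (hε : 0 < ε) (hε1 : ε < 1) :
    ∀ᶠ h : ℝ in atTop, ENNReal.ofReal ((1 - ε) * h) ≤ delay n f g (alarm n f g M h) := by
  have := (isSample_law_zero n f g).eventually_delay_alarmTime_ge
    (fun s => hasMoments_llr hgf hvar s.1) (fun s => hpos s.1) hM hε hε1
  filter_upwards [this] with h hh
  rwa [alarm_eq]

omit hfg hn in
lemma eventually_delay_voting_ge {M : ℕ} (hM : 0 < M) {ε : ℝ} (hε : 0 < ε) (hε1 : ε < 1) :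
    ∀ᶠ h : ℝ in atTop, ENNReal.ofReal ((1 - ε) * h) ≤ delay n f g (voting n f g M h) := by
  filter_upwards [eventually_delay_alarm_ge (n := n) hgf hpos hvar hM hε hε1] with h hh
  refine hh.trans (lintegral_mono fun x => ?_)
  rw [alarm_eq, voting_eq]
  exact alarmTime_le_voteTime _ _ x

omit hn in
lemma eventually_arl_alarm_le {A : Finset (Sensor n)} {D : ℝ} (hD : ∀ s ∈ A, kld f g s.1 ≤ D)
    {δ : ℝ} (hδ : 0 < δ) :
    ∀ᶠ h : ℝ in atTop, arl n f g (alarm n f g A.card h) ≤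
      ENNReal.ofReal (Real.exp (D * h + δ * √h)) := by
  have : ∀ s : Sensor n, IsProbabilityMeasure ((g s.1).map (llr (g s.1) (f s.1))) := fun s =>
    Measure.isProbabilityMeasure_map (measurable_llr _ _).aemeasurable
  have : ∀ s : Sensor n, IsProbabilityMeasure ((f s.1).map (llr (g s.1) (f s.1))) := fun s =>
    Measure.isProbabilityMeasure_map (measurable_llr _ _).aemeasurable
  have := (isSample_law_top n f g).eventually_arl_alarmTime_le
    (fun s => lintegral_map_llr (hfg s.1) (hgf s.1)) (fun s => hasMoments_llr hgf hvar s.1)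
    (fun s => llrVar_ne_zero hfg hgf hpos hvar s.1) (fun s => hpos s.1) (A := A) rfl hD hδ
  filter_upwards [this] with h hh
  rwa [alarm_eq]

omit hn in
lemma eventuallyBetter_voting {M : ℕ} (hM : 0 < M) (hMN : M < ∑ l, n l) :
    EventuallyBetter n f g (voting n f g (∑ l, n l)) (voting n f g M) := by
  have : ∀ s : Sensor n, IsProbabilityMeasure ((g s.1).map (llr (g s.1) (f s.1))) := fun s =>
    Measure.isProbabilityMeasure_map (measurable_llr _ _).aemeasurable
  have : ∀ s : Sensor n, IsProbabilityMeasure ((f s.1).map (llr (g s.1) (f s.1))) := fun s =>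
    Measure.isProbabilityMeasure_map (measurable_llr _ _).aemeasurable
  rw [← card_sensor] at hMN
  obtain ⟨A, -, hA⟩ := Finset.exists_subset_card_eq (s := (Finset.univ : Finset (Sensor n)))
    hMN.le
  have hAne : A.Nonempty := Finset.card_pos.1 (hA ▸ hM)
  obtain ⟨s₀, -, hs₀⟩ := Finset.exists_mem_notMem_of_card_lt_card
    (by rw [Finset.card_univ]; omega : A.card < (Finset.univ : Finset (Sensor n)).card)
  refine eventually_exists_thresholds_of_lt (D := ∑ s : Sensor n, kld f g s.1)
    (D' := ∑ s ∈ A, kld f g s.1) (c := 1 / 4) (Finset.sum_pos (fun s _ => hpos s.1) hAne)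
    (Finset.sum_lt_sum_of_subset (Finset.subset_univ A) (Finset.mem_univ s₀) hs₀ (hpos _)
      fun s _ _ => (hpos s.1).le) (by norm_num) ?_ ?_ ?_ ?_
  · filter_upwards [eventually_ge_atTop 0] with h hh
    rw [voting_eq, Finset.sum_mul]
    exact (isSample_law_top n f g).lintegral_voteTime_ge
      (fun s => lintegral_exp_map_llr_le (hfg s.1) (hgf s.1)) (card_sensor n).symm
      (by rw [← card_sensor]; omega) fun s => mul_nonneg (hpos s.1).le hh
  · have := (isSample_law_top n f g).eventually_arl_voteTime_le
      (fun s => lintegral_map_llr (hfg s.1) (hgf s.1)) (fun s => hasMoments_llr hgf hvar s.1)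
      (fun s => llrVar_ne_zero hfg hgf hpos hvar s.1) (fun s => hpos s.1) hA one_pos
    filter_upwards [this] with h hh
    rwa [voting_eq]
  · exact fun ε hε => eventually_delay_voting_le hgf hpos hvar hε
  · exact fun ε hε hε1 => eventually_delay_voting_ge hgf hpos hvar hM hε hε1

lemma eventuallyBetter_alarm_of_lt (hlast : ∀ l < Fin.last K, kld f g l < kld f g (Fin.last K))
    {Ma M : ℕ} (hMa : Ma = ∑ l, n l - n (Fin.last K) + 1) (hM : 0 < M) (hMMa : M < Ma) :
    EventuallyBetter n f g (alarm n f g Ma) (alarm n f g M) := by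
  obtain ⟨A, hAs, hA⟩ := Finset.exists_subset_card_eq
    (s := Finset.univ.filter fun s : Sensor n => s.1 ≠ Fin.last K) (n := M)
    (by rw [card_filter_ne_last]; omega)
  have hAne : A.Nonempty := Finset.card_pos.1 (hA ▸ hM)
  have hlast0 : n (Fin.last K) ≤ ∑ l, n l :=
    Finset.single_le_sum (fun _ _ => Nat.zero_le _) (Finset.mem_univ _)
  have hB : 0 < (Finset.univ.filter fun s : Sensor n => s.1 = Fin.last K).card :=
    Finset.card_pos.2 ⟨⟨Fin.last K, ⟨0, hn _⟩⟩, by simp⟩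
  refine eventually_exists_thresholds_of_lt (D := kld f g (Fin.last K))
    (D' := A.sup' hAne fun s => kld f g s.1) ?_ ?_ ?_
    (eventually_arl_alarm_ge hfg hgf hn hpos hMa) ?_ ?_ ?_
  · obtain ⟨s, hs⟩ := hAne
    exact (hpos s.1).trans_le (Finset.le_sup' (fun s : Sensor n => kld f g s.1) hs)
  · exact (Finset.sup'_lt_iff hAne).2 fun s hs =>
      hlast s.1 (Fin.lt_last_iff_ne_last.2 (Finset.mem_filter.1 (hAs hs)).2)
  · positivity
  · rw [← hA]
    exact eventually_arl_alarm_le hfg hgf hpos hvar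
      (fun s hs => Finset.le_sup' (fun s : Sensor n => kld f g s.1) hs) one_pos
  · exact fun ε hε => eventually_delay_alarm_le hgf hpos hvar (by have := hn (Fin.last K); omega)
      hε
  · exact fun ε hε hε1 => eventually_delay_alarm_ge hgf hpos hvar hM hε hε1

/-- Both rules have exponent `kld f g (Fin.last K)`; for the competitor it is the largest drift
among any `M` sensors, by monotonicity. The decision therefore falls at order `√h`. -/
lemma eventuallyBetter_alarm_of_gt (hmono : Monotone (kld f g)) {Ma M : ℕ}
    (hMa : Ma = ∑ l, n l - n (Fin.last K) + 1) (hMaM : Ma < M) (hMN : M ≤ ∑ l, n l) :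
    EventuallyBetter n f g (alarm n f g Ma) (alarm n f g M) := by
  have : ∀ s : Sensor n, IsProbabilityMeasure ((g s.1).map (llr (g s.1) (f s.1))) := fun s =>
    Measure.isProbabilityMeasure_map (measurable_llr _ _).aemeasurable
  have hZ := isSample_law_zero n f g
  have hG := fun s : Sensor n => hasMoments_llr hgf hvar s.1
  have hB : 0 < (Finset.univ.filter fun s : Sensor n => s.1 = Fin.last K).card :=
    Finset.card_pos.2 ⟨⟨Fin.last K, ⟨0, hn _⟩⟩, by simp⟩
  obtain ⟨C, hC, hCle⟩ := hZ.exists_delay_alarmTime_le_add hG (fun s => hpos s.1) Ma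
  obtain ⟨a, ha, hgap⟩ := hZ.exists_eventually_delay_gap hG (fun s => hpos s.1)
    (fun s => llrVar_ne_zero hfg hgf hpos hvar s.1) hMaM (by rwa [card_sensor])
  obtain ⟨A, -, hA⟩ := Finset.exists_subset_card_eq (s := (Finset.univ : Finset (Sensor n)))
    (n := M) (by rwa [Finset.card_univ, card_sensor])
  refine eventually_exists_thresholds_of_gap (hpos (Fin.last K)) ?_ hC ha
    (eventually_arl_alarm_ge hfg hgf hn hpos hMa) ?_ ?_ ?_ ?_
  · positivity
  · intro δ hδ
    rw [← hA]
    exact eventually_arl_alarm_le hfg hgf hpos hvar (fun s _ => hmono (Fin.le_last _)) hδ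
  · filter_upwards [eventually_delay_alarm_le (n := n) (M := Ma) hgf hpos hvar (by omega)
      one_pos] with h hh
    exact ne_top_of_le_ne_top ENNReal.ofReal_ne_top hh
  · intro h₀ h hh
    rw [alarm_eq, alarm_eq]
    exact hCle h₀ h hh
  · filter_upwards [hgap] with h hh
    rw [alarm_eq, alarm_eq]
    exact hh

omit hn in
lemma eventually_alarmExpansion_lt
    (hlast : ∀ l < Fin.last K, kld f g l < kld f g (Fin.last K)) {Ma M : ℕ}
    (hMa : Ma = ∑ l, n l - n (Fin.last K) + 1) (hM : 0 < M) (hMN : M ≤ ∑ l, n l) (hne : M ≠ Ma) :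
    ∀ᶠ γ : ℝ in atTop, alarmExpansion n f g Ma γ < alarmExpansion n f g M γ := by
  have hMat : typeOf n Ma = Fin.last K := typeOf_eq_last (by omega)
  unfold alarmExpansion
  rw [hMat]
  rcases lt_or_gt_of_ne hne with h | h
  · exact eventually_expansion_lt _ _ (hpos _) (hlast _ (typeOf_lt_last hM (by omega)))
  · rw [typeOf_eq_last (m := M) (by omega)]
    have hxi : xi n f g Ma < xi n f g M := xi_lt hpos (fun l =>
      lt_of_le_of_ne (hasMoments_llr hgf hvar l).nonneg
        (llrVar_ne_zero hfg hgf hpos hvar l).symm) (by omega) h hMN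
    filter_upwards [eventually_gt_atTop 1] with γ hγ
    have h1 : 0 < √(Real.log γ / kld f g (Fin.last K)) :=
      Real.sqrt_pos.2 (div_pos (Real.log_pos hγ) (hpos _))
    exact add_lt_add_right (mul_lt_mul_of_pos_right hxi h1) _

omit hfg hgf hn hvar [∀ l, IsProbabilityMeasure (f l)] [∀ l, IsProbabilityMeasure (g l)] in
lemma eventually_votingExpansion_lt {M N : ℕ} (hM : 0 < M) (hMN : M < N) :
    ∀ᶠ γ : ℝ in atTop, votingExpansion n f g N γ < votingExpansion n f g M γ := by
  refine eventually_expansion_lt _ _ (Finset.sum_pos (fun m _ => hpos _)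
    (Finset.nonempty_Icc.2 hM)) ?_
  exact Finset.sum_lt_sum_of_subset (i := N) (Finset.Icc_subset_Icc_right hMN.le)
    (Finset.mem_Icc.2 ⟨by omega, le_rfl⟩) (fun h => by have := Finset.mem_Icc.1 h; omega)
    (hpos _) fun m _ _ => (hpos _).le

end Optimality

end HetQCD

/-! ### The main theorem -/

theorem corollary2 {𝓧 : Type*} [MeasurableSpace 𝓧] {K : ℕ} (n : Fin (K + 1) → ℕ)
    (f g : Fin (K + 1) → Measure 𝓧)
    [∀ l, IsProbabilityMeasure (f l)] [∀ l, IsProbabilityMeasure (g l)]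
    (hfg : ∀ l, f l ≪ g l) (hgf : ∀ l, g l ≪ f l)
    (hn : ∀ l, 0 < n l)
    (hpos : ∀ l, 0 < HetQCD.kld f g l)
    (hmono : Monotone (HetQCD.kld f g))
    (hlast : ∀ l < Fin.last K, HetQCD.kld f g l < HetQCD.kld f g (Fin.last K))
    (hvar : ∀ l, Integrable (fun x => (llr (g l) (f l) x - HetQCD.kld f g l) ^ 2) (g l))
    (N : ℕ) (hN : N = ∑ l, n l)
    (Ma : ℕ) (hMa : Ma = N - n (Fin.last K) + 1) :
    -- the choices are admissible
    (Ma ∈ Finset.Icc 1 N ∧ N ∈ Finset.Icc 1 N) ∧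
    -- for large `γ`, they are the unique minimizers of the second-order expansions
    (∀ᶠ γ : ℝ in atTop, ∀ M ∈ Finset.Icc 1 N,
      (M ≠ Ma → HetQCD.alarmExpansion n f g Ma γ < HetQCD.alarmExpansion n f g M γ) ∧
      (M ≠ N → HetQCD.votingExpansion n f g N γ < HetQCD.votingExpansion n f g M γ)) ∧
    -- for large `γ`, they give the smallest delay when the average run lengths equal `γ`
    (∀ᶠ γ : ℝ in atTop, ∀ M ∈ Finset.Icc 1 N, ∀ h h' : ℝ,
      (M ≠ Ma → HetQCD.arl n f g (HetQCD.alarm n f g Ma h) = ENNReal.ofReal γ →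
        HetQCD.arl n f g (HetQCD.alarm n f g M h') = ENNReal.ofReal γ →
        HetQCD.delay n f g (HetQCD.alarm n f g Ma h) <
          HetQCD.delay n f g (HetQCD.alarm n f g M h')) ∧
      (M ≠ N → HetQCD.arl n f g (HetQCD.voting n f g N h) = ENNReal.ofReal γ →
        HetQCD.arl n f g (HetQCD.voting n f g M h') = ENNReal.ofReal γ →
        HetQCD.delay n f g (HetQCD.voting n f g N h) <
          HetQCD.delay n f g (HetQCD.voting n f g M h'))) ∧
    -- for large `γ`, they give the smallest delay subject to an average run length above `γ`
    (∀ᶠ γ : ℝ in atTop, ∀ M ∈ Finset.Icc 1 N,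
      (M ≠ Ma → HetQCD.minDelay n f g (HetQCD.alarm n f g Ma) γ <
        HetQCD.minDelay n f g (HetQCD.alarm n f g M) γ) ∧
      (M ≠ N → HetQCD.minDelay n f g (HetQCD.voting n f g N) γ <
        HetQCD.minDelay n f g (HetQCD.voting n f g M) γ)) := by
  subst hN
  have hlast0 : n (Fin.last K) ≤ ∑ l, n l :=
    Finset.single_le_sum (fun _ _ => Nat.zero_le _) (Finset.mem_univ _)
  have hn0 := hn (Fin.last K)
  have hA : ∀ M ∈ Finset.Icc 1 (∑ l, n l), M ≠ Ma →
      HetQCD.EventuallyBetter n f g (HetQCD.alarm n f g Ma) (HetQCD.alarm n f g M) := by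
    intro M hM hne
    obtain ⟨h1, h2⟩ := Finset.mem_Icc.1 hM
    rcases lt_or_gt_of_ne hne with h | h
    · exact HetQCD.eventuallyBetter_alarm_of_lt hfg hgf hn hpos hvar hlast hMa h1 h
    · exact HetQCD.eventuallyBetter_alarm_of_gt hfg hgf hn hpos hvar hmono hMa h h2
  have hV : ∀ M ∈ Finset.Icc 1 (∑ l, n l), M ≠ ∑ l, n l →
      HetQCD.EventuallyBetter n f g (HetQCD.voting n f g (∑ l, n l)) (HetQCD.voting n f g M) := by
    intro M hM hne
    obtain ⟨h1, h2⟩ := Finset.mem_Icc.1 hM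
    exact HetQCD.eventuallyBetter_voting hfg hgf hpos hvar h1 (lt_of_le_of_ne h2 hne)
  have hA' := fun M hM hne => (hA M hM hne).delay_lt
    (fun _ _ hh => HetQCD.alarm_mono hpos Ma hh) (fun _ _ hh => HetQCD.alarm_mono hpos M hh)
  have hV' := fun M hM hne => (hV M hM hne).delay_lt
    (fun _ _ hh => HetQCD.voting_mono hpos _ hh) (fun _ _ hh => HetQCD.voting_mono hpos M hh)
  -- There are finitely many `M`, so the separate bounds on `γ` combine into one.
  refine ⟨⟨Finset.mem_Icc.2 ⟨by omega, by omega⟩, Finset.mem_Icc.2 ⟨by omega, le_rfl⟩⟩,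
    (Filter.eventually_all_finset _).2 fun M hM => ?_,
    (Filter.eventually_all_finset _).2 fun M hM => ?_,
    (Filter.eventually_all_finset _).2 fun M hM => ?_⟩
  · obtain ⟨h1, h2⟩ := Finset.mem_Icc.1 hM
    refine (Filter.eventually_imp_distrib_left.2 fun hne => ?_).and
      (Filter.eventually_imp_distrib_left.2 fun hne => ?_)
    · exact HetQCD.eventually_alarmExpansion_lt hfg hgf hpos hvar hlast hMa h1 h2 hne
    · exact HetQCD.eventually_votingExpansion_lt hpos h1 (lt_of_le_of_ne h2 hne)
  · filter_upwards [Filter.eventually_imp_distrib_left.2 (hA' M hM),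
      Filter.eventually_imp_distrib_left.2 (hV' M hM)] with γ h1 h2 h h'
    exact ⟨fun hne => (h1 hne).1 h h', fun hne => (h2 hne).1 h h'⟩
  · filter_upwards [Filter.eventually_imp_distrib_left.2 (hA' M hM),
      Filter.eventually_imp_distrib_left.2 (hV' M hM)] with γ h1 h2
    exact ⟨fun hne => (h1 hne).2, fun hne => (h2 hne).2⟩
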